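/- **Setting.** Let $d\ge 1$, $L>0$, $N\ge 2$ an even integer, $\mathbf j_*\in\mathbb Z^d\setminus\{\mathbf 0\}$ and $\phi>0$ (the Fourier component $\phi_{\mathbf j_*}=\phi_{-\mathbf j_*}$ of the pair potential). For $\mathbf j\in\mathbb Z^d$ put $k_{\mathbf j}=\frac{2\pi}{L}\mathbf j$, and let $a_{\mathbf j},a^*_{\mathbf j}$ be the bosonic annihilation and creation operators of the modes $\mathbf j$. On the $N$-particle Fock space $\mathcal F^N$ over $L^2$ of the periodic box of side $L$ let $$W=\phi\,\frac{a^*_{\mathbf 0}a^*_{\mathbf 0}a_{\mathbf j_*}a_{-\mathbf j_*}}{N},\qquad W^*=\phi\,\frac{a_{\mathbf 0}a_{\mathbf 0}a^*_{\mathbf j_*}a^*_{-\mathbf j_*}}{N},$$ $$H=\sum_{\mathbf j\ne\pm\mathbf j_*}k_{\mathbf j}^2\,a^*_{\mathbf j}a_{\mathbf j}+\Big(k_{\mathbf j_*}^2+\phi\,\frac{a^*_{\mathbf 0}a_{\mathbf 0}}{N}\Big)\big(a^*_{\mathbf j_*}a_{\mathbf j_*}+a^*_{-\mathbf j_*}a_{-\mathbf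 j_*}\big)+W+W^* .$$ Let $\eta=\frac1{\sqrt{N!}}(a^*_{\mathbf 0})^N\Omega$, $\epsilon=k_{\mathbf j_*}^2/\phi$ and $E^{Bog}=-\big[k_{\mathbf j_*}^2+\phi-\sqrt{(k_{\mathbf j_*}^2)^2+2\phi k_{\mathbf j_*}^2}\,\big]$. For even $0\le i\le N-2$ let $Q^{(i,i+1)}$ be the orthogonal projection onto the states with $N-i$ or $N-i-1$ particles in the modes $\pm\mathbf j_*$, and for $z\in\mathbb R$ let $$R_{i}(z)=Q^{(i,i+1)}\frac{1}{Q^{(i,i+1)}(H-z)Q^{(i,i+1)}}Q^{(i,i+1)}$$ (inverse on the range of $Q^{(i,i+1)}$). Put $\Gamma_0(z)=0$ and, for even $2\le i\le N-2$, $$\Gamma_i(z)=Q^{(i,i+1)}WQ^{(i-2,i-1)}\,R_{i-2}(z)\sum_{l=0}^\infty\big[\Gamma_{i-2}(z)R_{i-2}(z)\big]^l\,Q^{(i-2,i-1)}W^*Q^{(i,i+1)},$$ and define $$f(z)=-z-\Big\langle\eta,\;W\,R_{N-2}(z)\sum_{l=0}^\infty\big[\Gamma_{N-2}(z)R_{N-2}(z)\big]^l\,W^*\eta\Big\rangle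 .$$ We say that $f(z)$ is well defined if, for every even $0\le i\le N-2$, $Q^{(i,i+1)}(H-z)Q^{(i,i+1)}$ is boundedly invertible on the range of $Q^{(i,i+1)}$ and the series $\sum_l[\Gamma_i(z)R_i(z)]^l$ converges in operator norm. **Theorem.** For every $0<\gamma<1$ there are constants $k_\gamma>0$ and $\epsilon_0>0$, depending only on $\gamma$, such that the following holds for all $d,L,N,\mathbf j_*,\phi$ as above with $\epsilon\le\epsilon_0$ and $$\epsilon^2+\frac{\epsilon}{N^{\gamma}}+\frac1N\le k_\gamma\,\epsilon\sqrt\epsilon,\qquad \frac{1}{N^{1-\gamma}}\le k_\gamma\,\epsilon .$$ Put $z_{\max}=E^{Bog}+\sqrt\epsilon\,\phi\sqrt{\epsilon^2+2\epsilon}$. Then $z_{\max}<0$; $f(z)$ is well defined for every real $z\le z_{\max}$; there is exactly one point $z_*\le z_{\max}$ with $f(z_*)=0$; and $$z_*<E^{Bog}+\frac{2\sqrt2+3}{6}\,\sqrt\epsilon\,\phi\,\sqrt{\epsilon^2+2\epsilon}.$$ -/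

import Mathlib

namespace ThreeModeBog

noncomputable section

/-- Modes of the periodic box: `j` labels the plane wave of momentum `k_j = (2π/L) j`. -/
abbrev Mode (d : ℕ) : Type := Fin d → ℤ

/-- Occupation numbers of `N` bosons: finitely supported `n` with `∑ j, n j = N`. -/
abbrev Occ (d N : ℕ) : Type := {n : Mode d →₀ ℕ // n.degree = N}

/-- The `N`-particle subspace of the bosonic Fock space over `L²` of the box, in the occupation
number representation: `ψ n` is the coefficient of `ψ` along the normalized product state
`∏ j, (a*_j)^(n j) / √(n j)! Ω` (these states form an orthonormal basis). -/
abbrev FockN (d N : ℕ) : Type := lp (fun _ : Occ d N => ℂ) 2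

section WeightedShift

variable {A B : Type*}

/-- Coefficients of a weighted shift: `a ↦ w a * ψ (g a)`, and `0` where `g a` is undefined. -/
def shiftFun (g : A → Option B) (w : A → ℂ) (ψ : B → ℂ) (a : A) : ℂ :=
  (g a).elim 0 (fun b => w a * ψ b)

theorem shiftFun_sum_le (g : A → Option B)
    (hg : ∀ a a' b, g a = some b → g a' = some b → a = a') (w : A → ℂ) (C : ℝ)
    (hw : ∀ a, ‖w a‖ ≤ C) (hC : 0 ≤ C) (ψ : lp (fun _ : B => ℂ) 2) (s : Finset A) :
    ∑ a ∈ s, ‖shiftFun g w ψ a‖ ^ (2 : ENNReal).toReal ≤ (C * ‖ψ‖) ^ (2 : ENNReal).toReal := by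
  classical
  have h2 : 0 < (2 : ENNReal).toReal := by norm_num
  have key : ∑ a ∈ s, ‖shiftFun g w ψ a‖ ^ (2 : ENNReal).toReal
      ≤ ∑ b ∈ s.filterMap g (fun a a' b h h' => hg a a' b h h'),
        C ^ (2 : ENNReal).toReal * ‖ψ b‖ ^ (2 : ENNReal).toReal := by
    induction s using Finset.induction_on with
    | empty => simp
    | insert a s ha ih =>
      rw [Finset.sum_insert ha]
      cases hga : g a with
      | none =>
        have h0 : shiftFun g w ψ a = 0 := by simp [shiftFun, hga]
        rw [h0, norm_zero, Real.zero_rpow h2.ne', zero_add]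
        refine ih.trans (le_of_eq ?_)
        congr 1
        ext b
        simp only [Finset.mem_filterMap, Finset.mem_insert]
        constructor
        · rintro ⟨x, hx, hxb⟩
          exact ⟨x, Or.inr hx, hxb⟩
        · rintro ⟨x, rfl | hx, hxb⟩
          · simp [hga] at hxb
          · exact ⟨x, hx, hxb⟩
      | some b =>
        have h1 : (insert a s).filterMap g (fun a a' b h h' => hg a a' b h h')
            = insert b (s.filterMap g (fun a a' b h h' => hg a a' b h h')) := by
          ext c
          simp only [Finset.mem_filterMap, Finset.mem_insert]
          constructor
          · rintro ⟨x, rfl | hx, hxc⟩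
            · left
              rw [hga] at hxc
              exact (Option.some.inj hxc).symm
            · exact Or.inr ⟨x, hx, hxc⟩
          · rintro (rfl | ⟨x, hx, hxc⟩)
            · exact ⟨a, Or.inl rfl, hga⟩
            · exact ⟨x, Or.inr hx, hxc⟩
        have h3 : b ∉ s.filterMap g (fun a a' b h h' => hg a a' b h h') := by
          simp only [Finset.mem_filterMap]
          rintro ⟨x, hx, hxb⟩
          exact ha (hg a x b hga hxb ▸ hx)
        rw [h1, Finset.sum_insert h3]
        refine add_le_add ?_ ih
        have h4 : shiftFun g w ψ a = w a * ψ b := by simp [shiftFun, hga]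
        rw [h4, norm_mul, Real.mul_rpow (norm_nonneg _) (norm_nonneg _)]
        gcongr
        exact hw a
  refine key.trans ?_
  rw [← Finset.mul_sum, Real.mul_rpow hC (norm_nonneg _)]
  gcongr
  exact lp.sum_rpow_le_norm_rpow h2 ψ _

/-- The bounded operator `ψ ↦ (a ↦ w a * ψ (g a))` between `ℓ²` spaces, for a bounded weight `w`
and a partially defined injective map `g`. -/
def shiftCLM (g : A → Option B) (hg : ∀ a a' b, g a = some b → g a' = some b → a = a')
    (w : A → ℂ) (C : ℝ) (hw : ∀ a, ‖w a‖ ≤ C) (hC : 0 ≤ C) :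
    lp (fun _ : B => ℂ) 2 →L[ℂ] lp (fun _ : A => ℂ) 2 :=
  LinearMap.mkContinuous
    { toFun := fun ψ => ⟨shiftFun g w ψ, memℓp_gen' (shiftFun_sum_le g hg w C hw hC ψ)⟩
      map_add' := by
        intro x y
        ext a
        change shiftFun g w _ a = shiftFun g w x a + shiftFun g w y a
        cases hga : g a <;> simp [shiftFun, hga, mul_add]
      map_smul' := by
        intro c x
        ext a
        cases hga : g a <;> simp [shiftFun, hga, mul_left_comm] }
    C
    (by
      intro ψ
      refine lp.norm_le_of_forall_sum_le (by norm_num) (by positivity) ?_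
      intro s
      exact shiftFun_sum_le g hg w C hw hC ψ s)

end WeightedShift

/-- `n ↦ n + δ_j`, from `N - 1` to `N` particles (undefined if `N = 0`). -/
def addOne (d N : ℕ) (j : Mode d) (n : Occ d (N - 1)) : Option (Occ d N) :=
  if h : (n.1 + Finsupp.single j 1).degree = N then some ⟨n.1 + Finsupp.single j 1, h⟩ else none

theorem addOne_inj (d N : ℕ) (j : Mode d) (n n' : Occ d (N - 1)) (m : Occ d N)
    (h : addOne d N j n = some m) (h' : addOne d N j n' = some m) : n = n' := by
  unfold addOne at h h'
  split_ifs at h h'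
  have e := Option.some.inj (h.trans h'.symm)
  exact Subtype.ext (add_right_cancel (congrArg Subtype.val e))

theorem sqrt_occ_le (d N : ℕ) (j : Mode d) (n : Occ d (N - 1)) :
    ‖((Real.sqrt ((n.1 j : ℝ) + 1) : ℝ) : ℂ)‖ ≤ Real.sqrt ((N : ℝ) + 1) := by
  rw [Complex.norm_real, Real.norm_of_nonneg (Real.sqrt_nonneg _)]
  apply Real.sqrt_le_sqrt
  have h1 : n.1 j ≤ n.1.degree := Finsupp.le_degree j n.1
  have h2 : n.1 j ≤ N := by
    have := n.2
    omega
  have h3 : (n.1 j : ℝ) ≤ N := by exact_mod_cast h2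
  linarith

/-- The annihilation operator `a_j`, from `N` to `N - 1` particles:
`(a_j ψ)(n) = √(n_j + 1) ψ(n + δ_j)`; it is `0` on the vacuum sector `N = 0`. -/
def annih (d N : ℕ) (j : Mode d) : FockN d N →L[ℂ] FockN d (N - 1) :=
  shiftCLM (addOne d N j) (addOne_inj d N j) (fun n => ((Real.sqrt ((n.1 j : ℝ) + 1) : ℝ) : ℂ))
    (Real.sqrt ((N : ℝ) + 1)) (sqrt_occ_le d N j) (Real.sqrt_nonneg _)

/-- The creation operator `a*_j`, from `N - 1` to `N` particles. -/
def create (d N : ℕ) (j : Mode d) : FockN d (N - 1) →L[ℂ] FockN d N :=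
  ContinuousLinearMap.adjoint (annih d N j)

/-- The number operator `a*_j a_j` on the `N`-particle space. -/
def num (d N : ℕ) (j : Mode d) : FockN d N →L[ℂ] FockN d N :=
  create d N j ∘L annih d N j

/-- The kinetic energy `k_j² = |2π j / L|²` of the mode `j` (with `m = 1/2`). -/
def kSq {d : ℕ} (L : ℝ) (j : Mode d) : ℝ := ∑ i, (2 * Real.pi / L * (j i : ℝ)) ^ 2

/-- `W = φ a*_0 a*_0 a_{j*} a_{-j*} / N`. -/
def W (d N : ℕ) (φ : ℝ) (js : Mode d) : FockN d N →L[ℂ] FockN d N :=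
  ((φ / N : ℝ) : ℂ) • (create d N 0 ∘L create d (N - 1) 0 ∘L annih d (N - 1) js ∘L annih d N (-js))

/-- `W* = φ a_0 a_0 a*_{j*} a*_{-j*} / N`. -/
def Wstar (d N : ℕ) (φ : ℝ) (js : Mode d) : FockN d N →L[ℂ] FockN d N :=
  ContinuousLinearMap.adjoint (W d N φ js)

/-- `Ĥ⁰ = (k² + φ a*_0 a_0 / N) a*_{j*} a_{j*} + (k² + φ a*_0 a_0 / N) a*_{-j*} a_{-j*}`
with `k² = k_{j*}²`. -/
def hHat0 (d N : ℕ) (L φ : ℝ) (js : Mode d) : FockN d N →L[ℂ] FockN d N :=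
  (((kSq L js : ℝ) : ℂ) • 1 + ((φ / N : ℝ) : ℂ) • num d N 0) * num d N js +
    (((kSq L js : ℝ) : ℂ) • 1 + ((φ / N : ℝ) : ℂ) • num d N 0) * num d N (-js)

/-- The value of `∑_{j ≠ ±j*} k_j² a*_j a_j` on the product state with occupation numbers `n`. -/
def kinOther {d N : ℕ} (L : ℝ) (js : Mode d) (n : Occ d N) : ℝ :=
  n.1.sum (fun j m => if j = js ∨ j = -js then 0 else kSq L j * m)

/-- The (unbounded, self-adjoint) operator `∑_{j ≠ ±j*} k_j² a*_j a_j` on its natural domain. -/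
def kinetic (d N : ℕ) (L : ℝ) (js : Mode d) : FockN d N →ₗ.[ℂ] FockN d N where
  domain :=
    { carrier := {ψ | Memℓp (fun n : Occ d N => (kinOther L js n : ℂ) * ψ n) 2}
      zero_mem' := by
        have h : (fun n : Occ d N => (kinOther L js n : ℂ) * (0 : FockN d N) n) = 0 := by
          ext n
          simp
        change Memℓp _ 2
        rw [h]
        exact zero_memℓp
      add_mem' := by
        intro a b ha hb
        have h := Memℓp.add ha hb
        refine (congrArg (fun f => Memℓp f 2) ?_).mp h
        ext n
        simp [mul_add]
      smul_mem' := by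
        intro c a ha
        have h := Memℓp.const_smul ha c
        refine (congrArg (fun f => Memℓp f 2) ?_).mp h
        ext n
        simp [mul_left_comm] }
  toFun :=
    { toFun := fun ψ => ⟨fun n => (kinOther L js n : ℂ) * ψ.1 n, ψ.2⟩
      map_add' := by
        intro x y
        ext n
        exact mul_add _ _ _
      map_smul' := by
        intro c x
        ext n
        simp [mul_left_comm] }

/-- The three-modes Bogoliubov Hamiltonian
`H = ∑_{j ≠ ±j*} k_j² a*_j a_j + Ĥ⁰ + W + W*` on the `N`-particle space. -/
def hBog (d N : ℕ) (L φ : ℝ) (js : Mode d) : FockN d N →ₗ.[ℂ] FockN d N where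
  domain := (kinetic d N L js).domain
  toFun := (kinetic d N L js).toFun +
    ((hHat0 d N L φ js + W d N φ js + Wstar d N φ js : FockN d N →L[ℂ] FockN d N) :
      FockN d N →ₗ[ℂ] FockN d N).domRestrict (kinetic d N L js).domain

open Classical in
/-- `Q^{(i,i+1)}`: the orthogonal projection onto the states with `N - i` or `N - i - 1`
particles in the modes `±j*`. -/
def Q (d N : ℕ) (js : Mode d) (i : ℕ) : FockN d N →L[ℂ] FockN d N :=
  shiftCLM some (fun _ _ _ h h' => Option.some.inj (h.trans h'.symm))
    (fun n => if n.1 js + n.1 (-js) + i = N ∨ n.1 js + n.1 (-js) + i + 1 = N then 1 else 0) 1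
    (by
      intro n
      split_ifs <;> simp)
    zero_le_one

/-- `R = Q (Q (H - z) Q)⁻¹ Q`: the bounded operator that vanishes on `(Q E)ᗮ` and on `Q E` is the
inverse of the (possibly unbounded) operator `Q (H - z) Q`. Such an `R` is unique. -/
structure IsReducedResolvent {E : Type*} [NormedAddCommGroup E] [NormedSpace ℂ E]
    (H : E →ₗ.[ℂ] E) (Q : E →L[ℂ] E) (z : ℂ) (R : E →L[ℂ] E) : Prop where
  left_proj : Q * R = R
  right_proj : R * Q = R
  mem_domain : ∀ ψ, R ψ ∈ H.domain
  right_inv : ∀ ψ, Q (H ⟨R ψ, mem_domain ψ⟩ - z • R ψ) = Q ψ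
  left_inv : ∀ ψ : H.domain, Q ψ = ψ → R (Q (H ψ - z • (ψ : E))) = ψ

open Classical in
/-- The operator `R` above if it exists (and `0` otherwise). -/
def reducedResolvent {E : Type*} [NormedAddCommGroup E] [NormedSpace ℂ E]
    (H : E →ₗ.[ℂ] E) (Q : E →L[ℂ] E) (z : ℂ) : E →L[ℂ] E :=
  if h : ∃ R, IsReducedResolvent H Q z R then h.choose else 0

/-- `R_{i,i}(z) = Q^{(i,i+1)} (Q^{(i,i+1)} (H - z) Q^{(i,i+1)})⁻¹ Q^{(i,i+1)}`. -/
def resBog (d N : ℕ) (L φ : ℝ) (js : Mode d) (z : ℝ) (i : ℕ) : FockN d N →L[ℂ] FockN d N :=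
  reducedResolvent (hBog d N L φ js) (Q d N js i) (z : ℂ)

/-- `gammaBog … k` is `Γ_{i,i}(z)` with `i = 2 k`:
`Γ_{i+2,i+2} = W_{i+2,i} R_{i,i} (∑_l [Γ_{i,i} R_{i,i}]^l) W*_{i,i+2}`, where
`W_{i,i'} = Q^{(i,i+1)} W Q^{(i',i'+1)}` and `W*_{i,i'} = Q^{(i,i+1)} W* Q^{(i',i'+1)}`.
The start `Γ_{0,0} = 0` gives `Γ_{2,2} = W_{2,0} R_{0,0} W*_{0,2}`. The series is taken in
operator norm. -/
def gammaBog (d N : ℕ) (L φ : ℝ) (js : Mode d) (z : ℝ) : ℕ → (FockN d N →L[ℂ] FockN d N)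
  | 0 => 0
  | k + 1 =>
    (Q d N js (2 * k + 2) * W d N φ js * Q d N js (2 * k)) * resBog d N L φ js z (2 * k) *
      (∑' l : ℕ, (gammaBog d N L φ js z k * resBog d N L φ js z (2 * k)) ^ l) *
      (Q d N js (2 * k) * Wstar d N φ js * Q d N js (2 * k + 2))

/-- `η = (1/√N!) (a*_0)^N Ω`: all particles in the zero mode. -/
def eta (d N : ℕ) : FockN d N :=
  open Classical in lp.single 2 (⟨Finsupp.single 0 N, by simp⟩ : Occ d N) (1 : ℂ)

/-- `f(z) = -z - ⟨η, W R_{N-2,N-2}(z) (∑_l [Γ_{N-2,N-2}(z) R_{N-2,N-2}(z)]^l) W* η⟩`, for even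
`N ≥ 2` (so that `2 (N / 2 - 1) = N - 2`). -/
def f (d N : ℕ) (L φ : ℝ) (js : Mode d) (z : ℝ) : ℂ :=
  -(z : ℂ) - inner ℂ (eta d N)
    ((W d N φ js * resBog d N L φ js z (N - 2) *
      (∑' l : ℕ, (gammaBog d N L φ js z (N / 2 - 1) * resBog d N L φ js z (N - 2)) ^ l) *
      Wstar d N φ js) (eta d N))

/-- All the operators that enter `f(z)` exist: for each even `i = 2 k` with `0 ≤ i ≤ N - 2`, the
operator `Q^{(i,i+1)} (H - z) Q^{(i,i+1)}` is boundedly invertible on the range of `Q^{(i,i+1)}`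
and the Neumann series `∑_l [Γ_{i,i}(z) R_{i,i}(z)]^l` converges in operator norm. -/
def FWellDefined (d N : ℕ) (L φ : ℝ) (js : Mode d) (z : ℝ) : Prop :=
  ∀ k : ℕ, 2 * k + 2 ≤ N →
    (∃ R, IsReducedResolvent (hBog d N L φ js) (Q d N js (2 * k)) (z : ℂ) R) ∧
    Summable (fun l : ℕ => (gammaBog d N L φ js z k * resBog d N L φ js z (2 * k)) ^ l)

/-- `ε = k_{j*}² / φ`. -/
def eps {d : ℕ} (L φ : ℝ) (js : Mode d) : ℝ := kSq L js / φ

/-- The Bogoliubov energy `E = -[k² + φ - √((k²)² + 2 φ k²)]` with `k² = k_{j*}²`. -/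
def eBog {d : ℕ} (L φ : ℝ) (js : Mode d) : ℝ :=
  -(kSq L js + φ - Real.sqrt ((kSq L js) ^ 2 + 2 * φ * kSq L js))

end

end ThreeModeBog

/-! ### The scalar continued fraction behind the operator recursion. -/

namespace ThreeModeBog

/-! In the occupation basis, `W` links a product state only to the one with two particles moved
between the mode `0` and the pair `±j*`. So `H - z` splits into tridiagonal chains, and the kinetic
energy `κ` of the other modes is constant along each. `W` changes the number of particles in `±j*`
by two and hence leaves every sector `Q^{(i,i+1)}`. Therefore `Q (H - z) Q`, its inverse and all the
`Γ_i` are diagonal. The Neumann series is a geometric series in each entry, and the operator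
recursion becomes the continued fraction `schur`. In particular `f z` is its value at the condensate
state (`f_eq_schur`).

It remains to study scalars. Put `e = √ε` and `s = √(ε² + 2ε)`, so that `(1+ε+s)(1+ε-s) = 1` and the
energies are `φ(-(1+ε-s) + θ s)`, with `θ = e` at the threshold. An explicit subsolution, modelled
on the fixed point of the `N → ∞` recursion, bounds the continued fraction below by `κ` plus a
positive constant away from the condensate (`le_schur`, `exists_le_schur`). This gives the
resolvents and, uniformly in the unbounded `κ`, convergence of the Neumann series.

Positivity of the denominators also makes `f` continuous and decreasing with slope at most `-1`, so
it has at most one zero. An upper bound of the same shape on the chain `a = b`, with slope slightly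
perturbed to absorb the `1/N` errors, makes `f` negative already at `θ = e (2√2+3)/6`
(`schur_condensate_neg`). The zero thus exists and lies strictly below that energy
(`exists_unique_zero`). -/

/-- Diagonal matrix element of `H - z` on a product state with `a`, `b`, `c` particles in the modes
`j*`, `-j*`, `0`, where the other modes carry the kinetic energy `κ`. -/
noncomputable def lev (K φ : ℝ) (N : ℕ) (κ z : ℝ) (a b c : ℕ) : ℝ :=
  κ + (K + φ / N * c) * ((a : ℝ) + b) - z

/-- Schur complement of `H - z` onto a product state along the chain of states obtained from it by
repeatedly moving two particles from the mode `0` to the modes `±j*`. -/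
noncomputable def schur (K φ : ℝ) (N : ℕ) (κ z : ℝ) : ℕ → ℕ → ℕ → ℝ
  | a, b, 0 => lev K φ N κ z a b 0
  | a, b, 1 => lev K φ N κ z a b 1
  | a, b, c + 2 => lev K φ N κ z a b (c + 2) -
      (φ / N) ^ 2 * (((c : ℝ) + 2) * (c + 1) * (a + 1) * (b + 1)) /
        schur K φ N κ z (a + 1) (b + 1) c

/-! ### Inequalities between the scaled parameters. -/

section Parameters

/-- The scaled parameters: `e = √ε` is small and `s = √(ε² + 2ε)`. -/
structure Scaled (ε e s : ℝ) : Prop where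
  pos : 0 < e
  small : e ≤ 1 / 10
  sq : ε = e ^ 2
  s_pos : 0 < s
  s_sq : s ^ 2 = ε ^ 2 + 2 * ε

variable {ε e s : ℝ}

theorem Scaled.eps_pos (h : Scaled ε e s) : 0 < ε := by rw [h.sq]; exact pow_pos h.pos 2

theorem Scaled.eps_le (h : Scaled ε e s) : ε ≤ 0.01 := by
  have := h.pos; have := h.small; rw [h.sq]; nlinarith

theorem Scaled.le_s (h : Scaled ε e s) : 1.4 * e ≤ s := by
  by_contra! hh
  have := mul_self_lt_mul_self h.s_pos.le hh
  nlinarith [sq_nonneg ε, h.s_sq, h.sq, h.pos]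

theorem Scaled.s_le (h : Scaled ε e s) : s ≤ 1.5 * e := by
  by_contra! hh
  have := mul_self_lt_mul_self (by have := h.pos; positivity) hh
  have : ε ^ 2 ≤ 0.01 * ε := by nlinarith [h.eps_pos, h.eps_le]
  nlinarith [h.s_sq, h.sq, sq_nonneg e, pow_pos h.pos 2]

theorem Scaled.eps_le_s (h : Scaled ε e s) : ε ≤ s := by
  nlinarith [h.sq, h.pos, h.small, h.le_s]

/-- The Bogoliubov recursion (`N → ∞`) at energy `E + √ε s`, away from the condensate state. -/
theorem Scaled.bogoliubov_supersolution (h : Scaled ε e s) {M : ℝ} (hM : 3 ≤ M) :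
    M ^ 2 / (4 * (M * (1 + ε + s) / 2 - s)) ≤ M * (1 + ε - s) / 2 + s - e * s := by
  have he0 := h.pos
  have he := h.small
  have hs0 := h.s_pos
  have hs1 := h.le_s
  have hs2 := h.s_le
  have hε1 := h.eps_le
  have hε0 := h.eps_pos
  have hP : 0 < 4 * (M * (1 + ε + s) / 2 - s) := by nlinarith
  rw [div_le_iff₀ hP]
  -- Because `(1+ε+s)(1+ε-s) = 1`, the `M²` terms cancel once the denominator is cleared. What is
  -- left is `2s` times this inequality.
  have h1 : 2 * s * (1 - e) ≤ M * (2 * s - (1 + ε + s) * e) := by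
    have : 2 * s ≤ 3 * (2 * s - (1 + ε + s) * e) := by nlinarith
    have h2 : 0 ≤ 2 * s - (1 + ε + s) * e := by nlinarith
    nlinarith
  have h3 := mul_le_mul_of_nonneg_left h1 hs0.le
  have h4 : M ^ 2 * ((1 + ε) ^ 2 - s ^ 2) = M ^ 2 := by rw [h.s_sq]; ring
  nlinarith

/-- Here `m = a + b`, `y = c/N`, `n = 1/N`. For `n = 0` both sides are affine in `y`, and `y = 1` is
the Bogoliubov inequality with `M = m + 2`. The slack at `y = 0`, weighted by `1 - y`, pays for the
`n` term because `m n ≤ 1 - y`. -/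
theorem Scaled.supersolution (h : Scaled ε e s) {m A y n : ℝ} (hm : 1 ≤ m) (hn : 0 ≤ n) (hy0 : 0 ≤ y)
    (hy : y + m * n ≤ 1) (hA : A ≤ (m + 2) ^ 2 / (4 * ((m + 2) * (1 + ε + s) / 2 - s))) :
    (y + n) * (m * (1 + ε + s) / 2 - s) ≤
      (ε + y) * m + (1 + ε - s - e * s) - y * A := by
  have h1 := hA.trans (h.bogoliubov_supersolution (M := m + 2) (by linarith))
  have h2 := mul_le_mul_of_nonneg_left h1 hy0
  have e0 := h.pos
  have e1 := h.small
  have s0 := h.s_le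
  have s1 := h.s_pos
  have ε0 := h.eps_pos
  have ε1 := h.eps_le
  have hes : e * s ≤ 0.015 := by nlinarith
  have h3 : (1 + ε + s) / 2 ≤ ε * m + (1 + ε - s - e * s) := by nlinarith
  have h4 : m * n * ((1 + ε + s) / 2) ≤ (1 - y) * (ε * m + (1 + ε - s - e * s)) :=
    mul_le_mul (by linarith) h3 (by positivity)
      (by nlinarith [mul_nonneg (zero_le_one.trans hm) hn])
  nlinarith [mul_nonneg hn s1.le]

end Parameters

/-! ### Bounds, monotonicity and sign of the continued fraction. -/

section SchurEstimates

variable {ε e s φ K κ z : ℝ} {N : ℕ}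

theorem lev_of_scaled (hK : K = φ * ε) (a b c : ℕ) :
    lev K φ N κ z a b c = κ + φ * ((ε + c / N) * ((a : ℝ) + b)) - z := by
  unfold lev; rw [hK]; ring

/-- Lower bound for the Schur complements at energies up to `E + √ε φ s`. -/
theorem le_schur (h : Scaled ε e s) (hφ : 0 < φ) (hK : K = φ * ε) (hN : 0 < N) (hκ : 0 ≤ κ)
    (hz : z ≤ φ * (-(1 + ε - s) + e * s)) :
    ∀ c a b : ℕ, 1 ≤ a + b → a + b + c ≤ N →
      κ + φ * (((c : ℝ) / N + 1 / N) * (((a : ℝ) + b) * (1 + ε + s) / 2 - s)) ≤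
        schur K φ N κ z a b c := by
  have hNr : (0 : ℝ) < N := by exact_mod_cast hN
  have e0 := h.pos
  have e1 := h.small
  have s0 := h.s_le
  have s1 := h.s_pos
  have ε0 := h.eps_pos
  have pos : ∀ m : ℝ, 1 ≤ m → 0 < m * (1 + ε + s) / 2 - s := fun m hm => by nlinarith
  have base : ∀ c a b : ℕ, 1 ≤ a + b → a + b + c ≤ N → ∀ A : ℝ,
      A ≤ ((a : ℝ) + b + 2) ^ 2 / (4 * (((a : ℝ) + b + 2) * (1 + ε + s) / 2 - s)) →
      κ + φ * (((c : ℝ) / N + 1 / N) * (((a : ℝ) + b) * (1 + ε + s) / 2 - s)) ≤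
        lev K φ N κ z a b c - φ * (c / N * A) := by
    intro c a b hab hc A hA
    have hab' : (1 : ℝ) ≤ (a : ℝ) + b := by exact_mod_cast hab
    have hc' : (a : ℝ) + b + c ≤ N := by exact_mod_cast hc
    have := h.supersolution (m := a + b) (A := A) (y := c / N) (n := 1 / N) hab' (by positivity)
      (by positivity) (by
        rw [mul_one_div, ← add_div, div_le_one hNr]; linarith) hA
    have := mul_le_mul_of_nonneg_left this hφ.le
    rw [lev_of_scaled hK]
    nlinarith
  -- No coupling (`A = 0`): the case where the chain ends, `c = 0` or `c = 1`.
  have base0 : ∀ c a b : ℕ, 1 ≤ a + b → a + b + c ≤ N →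
      κ + φ * (((c : ℝ) / N + 1 / N) * (((a : ℝ) + b) * (1 + ε + s) / 2 - s)) ≤
        lev K φ N κ z a b c := by
    intro c a b hab hc
    have hab' : (1 : ℝ) ≤ (a : ℝ) + b := by exact_mod_cast hab
    have := base c a b hab hc 0 (by
      have := pos (a + b + 2) (by linarith)
      positivity)
    simpa using this
  intro c
  induction c using Nat.twoStepInduction with
  | zero => intro a b hab hc; simpa only [schur] using base0 0 a b hab hc
  | one => intro a b hab hc; simpa only [schur] using base0 1 a b hab hc
  | more c ih _ =>
    intro a b hab hc
    have hab' : (1 : ℝ) ≤ (a : ℝ) + b := by exact_mod_cast hab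
    have ih' := ih (a + 1) (b + 1) (by omega) (by omega)
    refine (base (c + 2) a b hab hc _ le_rfl).trans ?_
    rw [schur]
    refine sub_le_sub_left ?_ _
    push_cast at ih' ⊢
    have e2 : (a : ℝ) + 1 + (b + 1) = a + b + 2 := by ring
    rw [e2] at ih'
    set P := ((a : ℝ) + b + 2) * (1 + ε + s) / 2 - s with hP
    have hP0 : 0 < P := pos (a + b + 2) (by linarith)
    have h1 : 0 < φ * (((c : ℝ) / N + 1 / N) * P) := by positivity
    -- The offset `1/N` in the ansatz makes its factor `(c+1)/N` cancel the `c + 1` of the coupling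
    -- exactly. Then `4(a+1)(b+1) ≤ (a+b+2)²` reduces everything to `a + b`.
    calc _ ≤ (φ / N) ^ 2 * (((c : ℝ) + 2) * (c + 1) * (a + 1) * (b + 1)) /
          (φ * (((c : ℝ) / N + 1 / N) * P)) := by
            gcongr
            linarith
      _ = φ * (((c : ℝ) + 2) / N * (4 * ((a + 1) * (b + 1)) / (4 * P))) := by
            field_simp
      _ ≤ _ := by
            gcongr
            nlinarith [sq_nonneg ((a : ℝ) - b)]

/-- Uniform lower bound for the Schur complements. -/
theorem exists_le_schur (h : Scaled ε e s) (hφ : 0 < φ) (hK : K = φ * ε) (hN : 0 < N)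
    (hz : z ≤ φ * (-(1 + ε - s) + e * s)) :
    ∃ p > 0, ∀ κ, 0 ≤ κ → ∀ a b c : ℕ, 1 ≤ a + b → a + b + c ≤ N →
      κ + p ≤ schur K φ N κ z a b c := by
  have hNr : (0 : ℝ) < N := by exact_mod_cast hN
  have e0 := h.pos
  have e1 := h.small
  have s0 := h.s_le
  have s1 := h.s_pos
  have ε0 := h.eps_pos
  have pos : 0 < (1 + ε + s) / 2 - s := by linarith
  -- The bound of `le_schur` at its smallest, `c = 0` and `a + b = 1`, without `κ`.
  refine ⟨φ * ((1 / N) * ((1 + ε + s) / 2 - s)), by positivity, fun κ hκ a b c hab hc => ?_⟩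
  refine le_trans ?_ (le_schur h hφ hK hN hκ hz c a b hab hc)
  have hab' : (1 : ℝ) ≤ (a : ℝ) + b := by exact_mod_cast hab
  gcongr
  · have : (0 : ℝ) ≤ (c : ℝ) / N := by positivity
    linarith
  · nlinarith

theorem schur_le_lev {z : ℝ} (hpos : ∀ a b c : ℕ, 1 ≤ a + b → a + b + c ≤ N →
      0 < schur K φ N κ z a b c) {a b c : ℕ} (hc : a + b + c ≤ N) :
    schur K φ N κ z a b c ≤ lev K φ N κ z a b c := by
  match c with
  | 0 => simp [schur]
  | 1 => simp [schur]
  | c + 2 =>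
    rw [schur]
    have := hpos (a + 1) (b + 1) c (by omega) (by omega)
    have : 0 ≤ (φ / N) ^ 2 * (((c : ℝ) + 2) * (c + 1) * (a + 1) * (b + 1)) /
      schur K φ N κ z (a + 1) (b + 1) c := by positivity
    linarith

/-- The level falls with slope `-1` in `z`. By induction the denominators fall as well, so the
subtracted quotient grows. Positivity is needed only at the larger energy. -/
theorem schur_add_le {z z' : ℝ} (hzz : z ≤ z') (hpos : ∀ a b c : ℕ, 1 ≤ a + b → a + b + c ≤ N →
      0 < schur K φ N κ z' a b c) :
    ∀ c a b : ℕ, a + b + c ≤ N →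
      schur K φ N κ z' a b c + (z' - z) ≤ schur K φ N κ z a b c := by
  intro c
  induction c using Nat.twoStepInduction with
  | zero => intro a b hc; simp only [schur, lev]; linarith
  | one => intro a b hc; simp only [schur, lev]; linarith
  | more c ih _ =>
    intro a b hc
    have h1 := ih (a + 1) (b + 1) (by omega)
    have h2 := hpos (a + 1) (b + 1) c (by omega) (by omega)
    have h3 : (φ / N) ^ 2 * (((c : ℝ) + 2) * (c + 1) * (a + 1) * (b + 1)) /
          schur K φ N κ z (a + 1) (b + 1) c ≤
        (φ / N) ^ 2 * (((c : ℝ) + 2) * (c + 1) * (a + 1) * (b + 1)) /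
          schur K φ N κ z' (a + 1) (b + 1) c := by
      gcongr
      linarith
    simp only [schur, lev]
    linarith

theorem continuousOn_schur {S : Set ℝ} (hpos : ∀ z ∈ S, ∀ a b c : ℕ, 1 ≤ a + b → a + b + c ≤ N →
      0 < schur K φ N κ z a b c) :
    ∀ c a b : ℕ, a + b + c ≤ N → ContinuousOn (fun z => schur K φ N κ z a b c) S := by
  intro c
  induction c using Nat.twoStepInduction with
  | zero => intro a b hc; simp only [schur, lev]; fun_prop
  | one => intro a b hc; simp only [schur, lev]; fun_prop
  | more c ih _ =>
    intro a b hc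
    simp only [schur, lev]
    refine ContinuousOn.sub (by fun_prop) (ContinuousOn.div (by fun_prop)
      (ih (a + 1) (b + 1) (by omega)) fun z hz => ?_)
    exact (hpos z hz (a + 1) (b + 1) c (by omega) (by omega)).ne'

/-- One step of the upper bound for the Schur complements along the condensate chain. -/
theorem schur_step_le (hφ : 0 < φ) (hK : K = φ * ε) (hN : 0 < N) {r ρ θ : ℝ}
    (hr0 : 0 < r) (hr1 : r ≤ 1 / 2) (hr : r = (1 + ε - s) / 2 - ρ)
    {a c : ℕ} (hac : a + a + (c + 2) = N)
    (hpos : 0 < schur K φ N 0 (φ * (-(1 + ε - s) + θ * s)) (a + 1) (a + 1) c)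
    (hle : schur K φ N 0 (φ * (-(1 + ε - s) + θ * s)) (a + 1) (a + 1) c ≤
      φ * ((a + 1) / (2 * r)))
    (hρ : 1 + ε - r + 5 / 2 / N ≤ 1 / (4 * r)) :
    schur K φ N 0 (φ * (-(1 + ε - s) + θ * s)) a a (c + 2) ≤
      φ * (a / (2 * r)) + φ * (2 * ρ + 1 / N - θ * s) := by
  have hNr : (0 : ℝ) < N := by exact_mod_cast hN
  have hac' : (a : ℝ) + a + (c + 2) = N := by exact_mod_cast hac
  rw [schur, lev_of_scaled hK]
  set n : ℝ := 1 / N with hn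
  set m : ℝ := (a : ℝ) + a with hm
  have hn0 : 0 < n := by positivity
  have hm0 : 0 ≤ m := by positivity
  have hc : ((c + 2 : ℕ) : ℝ) / N = 1 - m * n := by
    push_cast; rw [hn]; field_simp; linarith
  -- From `(1 - mn)(1 - mn - n) ≥ 1 - 2mn - n`, after the upper bound for the denominator is
  -- inserted.
  have h1 : φ * ((1 - 2 * m * n - n) * (r * (m + 2))) ≤
      (φ / N) ^ 2 * (((c : ℝ) + 2) * (c + 1) * (a + 1) * (a + 1)) /
      schur K φ N 0 (φ * (-(1 + ε - s) + θ * s)) (a + 1) (a + 1) c := by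
    have h2 : (φ / N) ^ 2 * (((c : ℝ) + 2) * (c + 1) * (a + 1) * (a + 1)) /
        (φ * ((a + 1) / (2 * r))) ≤ (φ / N) ^ 2 * (((c : ℝ) + 2) * (c + 1) * (a + 1) * (a + 1)) /
      schur K φ N 0 (φ * (-(1 + ε - s) + θ * s)) (a + 1) (a + 1) c := by gcongr
    refine le_trans ?_ h2
    have h3 : (φ / N) ^ 2 * (((c : ℝ) + 2) * (c + 1) * (a + 1) * (a + 1)) /
        (φ * ((a + 1) / (2 * r))) =
        φ * ((((c : ℝ) + 2) / N) * (((c : ℝ) + 2) / N - n) * (r * (m + 2))) := by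
      rw [hn, hm]; field_simp; ring
    rw [h3]
    push_cast at hc
    rw [hc]
    gcongr
    nlinarith [mul_nonneg hm0 hn0.le, mul_nonneg (mul_nonneg hm0 hn0.le) hn0.le,
      sq_nonneg (m * n)]
  rw [hc]
  have h4 : φ * ((a : ℝ) / (2 * r)) = φ * (m * (1 / (4 * r))) := by
    rw [hm]; field_simp; ring
  rw [h4]
  have h5 : 5 / 2 / (N : ℝ) = 5 / 2 * n := by rw [hn]; ring
  rw [h5] at hρ
  -- With `1 + ε - s = 2ρ + 2r`, expansion leaves the errors `5r·mn + 2r·n - (1-2r)m²n`. As `r ≤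
  -- 1/2`, they are at most `(5/2)mn + n`, whence the `5/2` in `hρ` and the `1/N` in the conclusion.
  have h6 : (ε + (1 - m * n)) * m + (1 + ε - s - θ * s) - (1 - 2 * m * n - n) * (r * (m + 2)) ≤
      m * (1 / (4 * r)) + (2 * ρ + n - θ * s) := by
    have h7 := mul_le_mul_of_nonneg_left hρ hm0
    have h8 : 0 ≤ (1 - 2 * r) * (m * n * m) := by
      have : 0 ≤ m * n * m := by positivity
      exact mul_nonneg (by linarith) this
    have h9 : r * (m * n) ≤ 1 / 2 * (m * n) := by gcongr
    have h10 : r * n ≤ 1 / 2 * n := by gcongr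
    have h11 : s = 1 + ε - 2 * ρ - 2 * r := by linarith
    rw [h11]
    nlinarith
  have := mul_le_mul_of_nonneg_left h6 hφ.le
  nlinarith

/-- Constants for the upper bound along the condensate chain. -/
theorem Scaled.exists_slope (h : Scaled ε e s) (hN : 0 < N) {θ : ℝ} (hθ0 : 9 / 10 * e ≤ θ)
    (hNe : 1 / (N : ℝ) ≤ 1 / 10 * e ^ 3) :
    ∃ r ρ : ℝ, 0 < r ∧ r ≤ 1 / 2 ∧ r = (1 + ε - s) / 2 - ρ ∧
      1 + ε - r + 5 / 2 / N ≤ 1 / (4 * r) ∧ 1 / 2 * (1 + ε + s) ≤ 1 / (4 * r) ∧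
      2 * ρ + 1 / N - θ * s < 0 := by
  have hNr : (0 : ℝ) < N := by exact_mod_cast hN
  have e0 := h.pos
  have e1 := h.small
  have s0 := h.s_le
  have s1 := h.s_pos
  have s2 := h.le_s
  have ε0 := h.eps_pos
  have ε1 := h.eps_le
  have hn0 : 0 < 1 / (N : ℝ) := by positivity
  have h5 : 5 / 2 / (N : ℝ) = 5 / 2 * (1 / N) := by ring
  rw [h5]
  generalize 1 / (N : ℝ) = n at *
  -- `r = (1+ε-s)/2` solves `4r(1+ε-r) = 1`. Lowering it by `ρ` gains `4ρs` at first order. With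
  -- `2ρs = 5/2 · n` this outweighs the error, which costs `4ρs(1+ε-s)`, because `ε ≤ s`. Since `n ≤
  -- e³/10`, `ρ` is at most `e²/10`, well below `θ s`.
  obtain ⟨ρ, hρs⟩ : ∃ ρ : ℝ, ρ * s = 5 / 4 * n := ⟨5 / 4 * n / s, by field_simp⟩
  have hρ0 : 0 < ρ := by
    by_contra! hh
    nlinarith
  have he3 : 1 / 10 * e ^ 3 ≤ 1 / 100 * e ^ 2 := by nlinarith [pow_pos e0 2]
  have hρ1 : ρ ≤ 1 / 10 * e ^ 2 := by
    by_contra! hh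
    have : 1 / 10 * e ^ 2 * (1.4 * e) < ρ * s := by
      apply mul_lt_mul hh s2 (by positivity) hρ0.le
    nlinarith [pow_pos e0 3]
  have hneg : 2 * ρ + n - θ * s < 0 := by
    have : 9 / 10 * e * (1.4 * e) ≤ θ * s := mul_le_mul hθ0 s2 (by positivity) (by linarith)
    nlinarith [pow_pos e0 2]
  have hρ2 : ρ ≤ 0.001 := by nlinarith
  have hsε := h.eps_le_s
  have hr0 : 0 < (1 + ε - s) / 2 - ρ := by linarith
  have hα : 1 + ε - ((1 + ε - s) / 2 - ρ) + 5 / 2 * n ≤ 1 / (4 * ((1 + ε - s) / 2 - ρ)) := by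
    rw [le_div_iff₀ (by positivity)]
    have h5 : 5 / 2 * n = 2 * (ρ * s) := by rw [hρs]; ring
    rw [h5]
    have hts : (1 + ε - s) * (1 + ε + s) = 1 := by
      linear_combination (-1 : ℝ) * h.s_sq
    have h6 : 0 < ρ * s := by positivity
    have h7 : 0 ≤ ρ * s * (s - ε) := mul_nonneg h6.le (by linarith)
    have h8 : 0 ≤ ρ * s * ρ := by positivity
    have h9 : 0 ≤ ρ * ρ := by positivity
    linarith [hts, h7, h8, h9]
  exact ⟨_, ρ, hr0, by linarith, rfl, hα, by linarith, hneg⟩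

/-- The Schur complement onto the condensate state is negative slightly below the threshold. -/
theorem schur_condensate_neg (h : Scaled ε e s) (hφ : 0 < φ) (hK : K = φ * ε) (hN : 0 < N)
    (hE : Even N) {θ : ℝ} (hθ0 : 9 / 10 * e ≤ θ) (hθ : θ ≤ e) (hNe : 1 / (N : ℝ) ≤ 1 / 10 * e ^ 3) :
    schur K φ N 0 (φ * (-(1 + ε - s) + θ * s)) 0 0 N < 0 := by
  have e0 := h.pos
  have s1 := h.s_pos
  have hN2 : 2 ≤ N := by obtain ⟨k, hk⟩ := hE; omega
  have hz : φ * (-(1 + ε - s) + θ * s) ≤ φ * (-(1 + ε - s) + e * s) := by gcongr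
  have hpos : ∀ a b c : ℕ, 1 ≤ a + b → a + b + c ≤ N →
      0 < schur K φ N 0 (φ * (-(1 + ε - s) + θ * s)) a b c := by
    obtain ⟨p, hp, H⟩ := exists_le_schur h hφ hK hN hz
    intro a b c hab hc
    linarith [H 0 le_rfl a b c hab hc]
  obtain ⟨r, ρ, hr0, hr1, hr, hα, hα', hneg⟩ := h.exists_slope hN hθ0 hNe
  have key : ∀ c a : ℕ, 1 ≤ a → a + a + c = N →
      schur K φ N 0 (φ * (-(1 + ε - s) + θ * s)) a a c ≤ φ * (a / (2 * r)) := by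
    intro c
    induction c using Nat.twoStepInduction with
    | zero =>
      intro a ha hac
      rw [schur, lev_of_scaled hK]
      have ha' : (1 : ℝ) ≤ a := by exact_mod_cast ha
      have h1 : ε * (a + a) + (1 + ε - s - θ * s) ≤ a / (2 * r) := by
        have h2 : (a : ℝ) / (2 * r) = a * 2 * (1 / (4 * r)) := by field_simp; ring
        rw [h2]
        have h5 : (a : ℝ) * 2 * (1 / 2 * (1 + ε + s)) ≤ a * 2 * (1 / (4 * r)) := by gcongr
        have h6 : 0 ≤ θ * s := mul_nonneg (by linarith) s1.le
        have h7 : 0 ≤ (s - ε) * a := mul_nonneg (by linarith [h.eps_le_s]) (by linarith)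
        linarith [h.eps_le_s]
      have := mul_le_mul_of_nonneg_left h1 hφ.le
      simp only [Nat.cast_zero, zero_div, add_zero, zero_add]
      nlinarith
    | one =>
      intro a ha hac
      -- Excluded by parity: `2a + 1 = N` with `N` even.
      obtain ⟨k, hk⟩ := hE
      omega
    | more c ih _ =>
      intro a ha hac
      have h1 := ih (a + 1) (by omega) (by omega)
      push_cast at h1
      have := schur_step_le hφ hK hN hr0 hr1 hr hac (hpos _ _ _ (by omega) (by omega)) h1 hα
      have h3 : φ * (2 * ρ + 1 / N - θ * s) < 0 := mul_neg_of_pos_of_neg hφ hneg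
      linarith
  obtain ⟨c, rfl⟩ : ∃ c, N = c + 2 := ⟨N - 2, by omega⟩
  have h1 := key c 1 le_rfl (by omega)
  -- At `a = 0` the ansatz `φ a/(2r)` vanishes, and only the negative remainder is left.
  have := schur_step_le hφ hK hN hr0 hr1 hr (a := 0) (c := c) (by omega)
    (hpos _ _ _ (by omega) (by omega)) (by simpa using h1) hα
  have h3 : φ * (2 * ρ + 1 / (c + 2 : ℕ) - θ * s) < 0 := mul_neg_of_pos_of_neg hφ hneg
  simp only [Nat.cast_zero, zero_div, mul_zero, zero_add] at this
  linarith

end SchurEstimates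

open ContinuousLinearMap

/-! ### Multiplication operators on `ℓ²`. -/

section Diagonal

variable {A B : Type*}

/-- The operator `X` on `ℓ²` is multiplication by `v`. -/
def IsDiag (X : lp (fun _ : A => ℂ) 2 →L[ℂ] lp (fun _ : A => ℂ) 2) (v : A → ℝ) : Prop :=
  ∀ ψ n, X ψ n = (v n : ℂ) * ψ n

variable {X Y : lp (fun _ : A => ℂ) 2 →L[ℂ] lp (fun _ : A => ℂ) 2} {v w : A → ℝ}

theorem IsDiag.mul (hX : IsDiag X v) (hY : IsDiag Y w) : IsDiag (X * Y) (fun n => v n * w n) := by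
  intro ψ n
  rw [mul_apply_eq_comp, hX, hY]
  push_cast
  ring

theorem IsDiag.ext (hX : IsDiag X v) (hY : IsDiag Y w) (h : ∀ n, v n = w n) : X = Y := by
  ext ψ n
  rw [hX, hY, h]

theorem IsDiag.congr (hX : IsDiag X v) (h : ∀ n, v n = w n) : IsDiag X w := by
  intro ψ n
  rw [hX, h]

theorem IsDiag.norm_le (hX : IsDiag X v) {C : ℝ} (hC : 0 ≤ C) (h : ∀ n, |v n| ≤ C) : ‖X‖ ≤ C := by
  refine ContinuousLinearMap.opNorm_le_bound _ hC fun ψ => ?_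
  refine lp.norm_le_of_forall_sum_le (by norm_num) (by positivity) fun s => ?_
  have := shiftFun_sum_le (A := A) (B := A) some
    (fun _ _ _ h h' => Option.some.inj (h.trans h'.symm)) (fun n => (v n : ℂ)) C
    (fun n => by simpa using h n) hC ψ s
  refine le_trans (le_of_eq ?_) this
  refine Finset.sum_congr rfl fun n _ => ?_
  rw [hX]
  rfl

theorem IsDiag.exists_of_bounded (v : A → ℝ) (C : ℝ) (h : ∀ n, |v n| ≤ C) (hC : 0 ≤ C) :
    ∃ X, IsDiag X v :=
  ⟨shiftCLM some (fun _ _ _ h h' => Option.some.inj (h.trans h'.symm)) (fun n => (v n : ℂ)) C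
    (fun n => by simpa using h n) hC, fun _ _ => rfl⟩

theorem IsDiag.summable_pow (hX : IsDiag X v) {C : ℝ} (hC0 : 0 ≤ C) (hC : C < 1)
    (h : ∀ n, |v n| ≤ C) : Summable (fun l : ℕ => X ^ l) :=
  summable_geometric_of_norm_lt_one ((hX.norm_le hC0 h).trans_lt hC)

/-- The identity `(1 - X) ∑ X^l = 1` is read off coefficient by coefficient. -/
theorem IsDiag.tsum_pow (hX : IsDiag X v) {C : ℝ} (hC0 : 0 ≤ C) (hC : C < 1)
    (h : ∀ n, |v n| ≤ C) : IsDiag (∑' l : ℕ, X ^ l) (fun n => (1 - v n)⁻¹) := by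
  intro ψ n
  have h1 := mul_neg_geom_series X ((hX.norm_le hC0 h).trans_lt hC)
  have h2 := congrArg (fun Z : lp (fun _ : A => ℂ) 2 →L[ℂ] lp (fun _ : A => ℂ) 2 => Z ψ n) h1
  simp only [mul_apply_eq_comp, sub_apply,
    one_apply_eq_self, lp.coeFn_sub, Pi.sub_apply] at h2
  rw [hX] at h2
  have h3 : (1 - v n) ≠ 0 := by
    have := le_abs_self (v n)
    have := h n
    linarith
  have h4 : ((1 - v n : ℝ) : ℂ) ≠ 0 := by exact_mod_cast h3
  rw [Complex.ofReal_inv, eq_inv_mul_iff_mul_eq₀ h4, ← h2]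
  push_cast
  ring

theorem IsDiag.adjoint_eq (hX : IsDiag X v) : adjoint X = X := by
  symm
  rw [ContinuousLinearMap.eq_adjoint_iff]
  intro x y
  simp only [lp.inner_eq_tsum]
  refine tsum_congr fun n => ?_
  rw [hX, hX]
  simp
  ring

end Diagonal

/-! ### Creation and annihilation operators on product states, and the action of `W`. -/

section Ladder

variable {d N : ℕ}

open Classical in
/-- The product state with occupation numbers `n`. -/
noncomputable def basisVec (n : Occ d N) : FockN d N := lp.single 2 n (1 : ℂ)

theorem inner_basisVec (n : Occ d N) (ψ : FockN d N) : inner ℂ (basisVec n) ψ = ψ n := by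
  classical
  unfold basisVec
  rw [lp.inner_single_left]
  simp

theorem basisVec_apply_self (n : Occ d N) : basisVec n n = 1 := by
  classical
  unfold basisVec
  simp

theorem basisVec_apply_ne {n m : Occ d N} (h : m ≠ n) : basisVec n m = 0 := by
  classical
  unfold basisVec
  rw [lp.single_apply_ne _ _ _ h]

theorem addOne_eq_some {j : Mode d} {m : Occ d (N - 1)} {n : Occ d N}
    (h : n.1 = m.1 + Finsupp.single j 1) : addOne d N j m = some n := by
  have h1 : (m.1 + Finsupp.single j 1).degree = N := by rw [← h]; exact n.2
  unfold addOne
  rw [dif_pos h1]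
  exact congrArg some (Subtype.ext h.symm)

theorem addOne_eq_some_iff {j : Mode d} {m : Occ d (N - 1)} {n : Occ d N} :
    addOne d N j m = some n ↔ n.1 = m.1 + Finsupp.single j 1 := by
  refine ⟨fun h => ?_, addOne_eq_some⟩
  unfold addOne at h
  split_ifs at h with h1
  rw [← Option.some.inj h]

theorem annih_apply_eq {j : Mode d} (ψ : FockN d N) (m : Occ d (N - 1)) :
    annih d N j ψ m = shiftFun (addOne d N j)
      (fun n => ((Real.sqrt ((n.1 j : ℝ) + 1) : ℝ) : ℂ)) ψ m := rfl

theorem annih_apply {j : Mode d} {m : Occ d (N - 1)} {n : Occ d N}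
    (h : n.1 = m.1 + Finsupp.single j 1) (ψ : FockN d N) :
    annih d N j ψ m = (Real.sqrt (n.1 j) : ℝ) * ψ n := by
  rw [annih_apply_eq, shiftFun, addOne_eq_some h]
  simp [h]

theorem annih_basisVec {j : Mode d} {m : Occ d (N - 1)} {n : Occ d N}
    (h : n.1 = m.1 + Finsupp.single j 1) :
    annih d N j (basisVec n) = ((Real.sqrt (n.1 j) : ℝ) : ℂ) • basisVec m := by
  ext m'
  by_cases hm : m' = m
  · subst hm
    rw [annih_apply h, lp.coeFn_smul, Pi.smul_apply, basisVec_apply_self, basisVec_apply_self,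
      smul_eq_mul]
  · rw [lp.coeFn_smul, Pi.smul_apply, basisVec_apply_ne hm, smul_zero, annih_apply_eq, shiftFun]
    cases h' : addOne d N j m' with
    | none => rfl
    | some n' =>
      have hn : n' ≠ n := by
        rintro rfl
        rw [addOne_eq_some_iff] at h'
        exact hm (Subtype.ext (add_right_cancel (h'.symm.trans h)))
      simp [basisVec_apply_ne hn]

theorem annih_basisVec_of_eq_zero {j : Mode d} {n : Occ d N} (h : n.1 j = 0) :
    annih d N j (basisVec n) = 0 := by
  ext m
  rw [annih_apply_eq, shiftFun, lp.coeFn_zero, Pi.zero_apply]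
  cases h' : addOne d N j m with
  | none => rfl
  | some n' =>
    have hn : n' ≠ n := by
      rintro rfl
      rw [addOne_eq_some_iff] at h'
      simp [h'] at h
    simp [basisVec_apply_ne hn]

theorem create_apply_eq {j : Mode d} (ψ : FockN d (N - 1)) (n : Occ d N) :
    create d N j ψ n = inner ℂ (annih d N j (basisVec n)) ψ := by
  rw [← inner_basisVec, create, ContinuousLinearMap.adjoint_inner_right]

theorem create_apply {j : Mode d} {m : Occ d (N - 1)} {n : Occ d N}
    (h : n.1 = m.1 + Finsupp.single j 1) (ψ : FockN d (N - 1)) :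
    create d N j ψ n = (Real.sqrt (n.1 j) : ℝ) * ψ m := by
  rw [create_apply_eq, annih_basisVec h, inner_smul_left, inner_basisVec, Complex.conj_ofReal]

theorem create_apply_of_eq_zero {j : Mode d} {n : Occ d N} (h : n.1 j = 0) (ψ : FockN d (N - 1)) :
    create d N j ψ n = 0 := by
  rw [create_apply_eq, annih_basisVec_of_eq_zero h, inner_zero_left]

/-- Remove a particle from the mode `j`. -/
theorem exists_pred {j : Mode d} {n : Occ d N} (h : n.1 j ≠ 0) :
    ∃ m : Occ d (N - 1), n.1 = m.1 + Finsupp.single j 1 := by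
  have h1 : n.1 = (n.1 - Finsupp.single j 1) + Finsupp.single j 1 := by
    rw [tsub_add_cancel_of_le]
    simpa using Nat.one_le_iff_ne_zero.mpr h
  refine ⟨⟨n.1 - Finsupp.single j 1, ?_⟩, h1⟩
  have h2 := n.2
  rw [h1, map_add, Finsupp.degree_single] at h2
  omega

theorem isDiag_num (j : Mode d) : IsDiag (num d N j) (fun n => (n.1 j : ℝ)) := by
  intro ψ n
  rw [num, ContinuousLinearMap.comp_apply]
  by_cases h : n.1 j = 0
  · rw [create_apply_of_eq_zero h]
    simp [h]
  · obtain ⟨m, hm⟩ := exists_pred h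
    rw [create_apply hm, annih_apply hm, ← mul_assoc, ← Complex.ofReal_mul,
      Real.mul_self_sqrt (Nat.cast_nonneg _)]

variable {js : Mode d} {φ : ℝ}

theorem neg_ne_self_of_ne_zero (hjs : js ≠ 0) : -js ≠ js := by
  intro h
  apply hjs
  funext i
  have := congrFun h i
  simp at this
  simp
  omega

/-- `n'` arises from `n` by moving two particles from the mode `0` to the modes `±j*`. -/
def Promotes (js : Mode d) (n n' : Occ d N) : Prop :=
  n'.1 + Finsupp.single 0 2 = n.1 + Finsupp.single js 1 + Finsupp.single (-js) 1

/-- The occupation numbers after two particles have moved from the mode `0` to `±j*`. -/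
theorem exists_promote (js : Mode d) (n : Occ d N) (h : 2 ≤ n.1 0) :
    ∃ n' : Occ d N, Promotes js n n' := by
  have h1 : Finsupp.single 0 2 ≤ n.1 := by simpa using h
  refine ⟨⟨n.1 - Finsupp.single 0 2 + Finsupp.single js 1 + Finsupp.single (-js) 1, ?_⟩, ?_⟩
  · have h2 := n.2
    have h3 : n.1 = (n.1 - Finsupp.single 0 2) + Finsupp.single 0 2 := by
      rw [tsub_add_cancel_of_le h1]
    rw [h3, map_add, Finsupp.degree_single] at h2
    rw [map_add, map_add, Finsupp.degree_single, Finsupp.degree_single]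
    omega
  · have h3 : n.1 = (n.1 - Finsupp.single 0 2) + Finsupp.single 0 2 := by
      rw [tsub_add_cancel_of_le h1]
    dsimp only [Promotes]
    ext i
    have h4 := DFunLike.congr_fun h3 i
    simp only [Finsupp.add_apply] at h4 ⊢
    omega

theorem Promotes.apply {n n' : Occ d N} (h : Promotes js n n') (j : Mode d) :
    n'.1 j + (Finsupp.single 0 2 : Mode d →₀ ℕ) j =
      n.1 j + (Finsupp.single js 1 : Mode d →₀ ℕ) j + (Finsupp.single (-js) 1 : Mode d →₀ ℕ) j := by
  have := DFunLike.congr_fun h j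
  simpa using this

theorem Promotes.zero {n n' : Occ d N} (h : Promotes js n n') (hjs : js ≠ 0) :
    n'.1 0 + 2 = n.1 0 := by
  have := h.apply 0
  have h2 : -js ≠ 0 := neg_ne_zero.mpr hjs
  simpa [Finsupp.single_apply, hjs, h2] using this

theorem Promotes.pos {n n' : Occ d N} (h : Promotes js n n') (hjs : js ≠ 0) :
    n'.1 js = n.1 js + 1 := by
  have := h.apply js
  simpa [Finsupp.single_apply, hjs.symm, neg_ne_self_of_ne_zero hjs] using this

theorem Promotes.neg {n n' : Occ d N} (h : Promotes js n n') (hjs : js ≠ 0) :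
    n'.1 (-js) = n.1 (-js) + 1 := by
  have := h.apply (-js)
  have h2 : (0 : Mode d) ≠ -js := (neg_ne_zero.mpr hjs).symm
  simpa [Finsupp.single_apply, h2, (neg_ne_self_of_ne_zero hjs).symm] using this

/-- The matrix element of `W` between a product state and its promotion. -/
noncomputable def wCoeff (N : ℕ) (φ : ℝ) (js : Mode d) (n : Occ d N) : ℝ :=
  φ / N * Real.sqrt ((n.1 0 : ℝ) * (n.1 0 - 1) * (n.1 js + 1) * (n.1 (-js) + 1))

theorem W_apply_of_lt {n : Occ d N} (h : n.1 0 < 2) (ψ : FockN d N) : W d N φ js ψ n = 0 := by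
  rw [W, smul_apply, lp.coeFn_smul, Pi.smul_apply]
  simp only [ContinuousLinearMap.comp_apply]
  by_cases h0 : n.1 0 = 0
  · rw [create_apply_of_eq_zero h0, smul_zero]
  · obtain ⟨m, hm⟩ := exists_pred h0
    have hm0 : m.1 0 = 0 := by
      rw [hm] at h
      simp at h
      omega
    rw [create_apply hm, create_apply_of_eq_zero hm0, mul_zero, smul_zero]

theorem W_apply (hjs : js ≠ 0) {n n' : Occ d N} (h : Promotes js n n') (ψ : FockN d N) :
    W d N φ js ψ n = (wCoeff N φ js n : ℂ) * ψ n' := by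
  have hz := h.zero hjs
  rw [W, smul_apply, lp.coeFn_smul, Pi.smul_apply]
  simp only [ContinuousLinearMap.comp_apply]
  obtain ⟨m, hm⟩ := exists_pred (j := 0) (n := n) (by omega)
  have hm0 : m.1 0 + 1 = n.1 0 := by rw [hm]; simp
  obtain ⟨m', hm'⟩ := exists_pred (j := 0) (n := m) (by omega)
  obtain ⟨p, hp⟩ := exists_pred (j := -js) (n := n') (by rw [h.neg hjs]; omega)
  -- `m'` is the common `(N-2)`-particle state: `n` without two particles of the mode `0`, and `n'`
  -- without one of each mode `±j*`.
  have hp' : p.1 = m'.1 + Finsupp.single js 1 := by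
    ext i
    have h1 := h.apply i
    have h2 := DFunLike.congr_fun hm i
    have h3 := DFunLike.congr_fun hm' i
    have h4 := DFunLike.congr_fun hp i
    have h5 : (Finsupp.single 0 2 : Mode d →₀ ℕ) i = (Finsupp.single 0 1 : Mode d →₀ ℕ) i +
        (Finsupp.single 0 1 : Mode d →₀ ℕ) i := by
      rw [← Finsupp.add_apply, ← Finsupp.single_add]
    simp only [Finsupp.add_apply] at h2 h3 h4 ⊢
    omega
  have hpjs : p.1 js = n.1 js + 1 := by
    rw [← h.pos hjs, hp]
    simp [neg_ne_self_of_ne_zero hjs]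
  rw [create_apply hm, create_apply hm', annih_apply hp', annih_apply hp, smul_eq_mul,
    wCoeff, hpjs, h.neg hjs, ← hm0]
  push_cast
  have h6 : ((m.1 0 : ℝ) + 1) * (m.1 0 + 1 - 1) * (n.1 js + 1) * (n.1 (-js) + 1) =
      ((m.1 0 : ℝ) + 1) * m.1 0 * (n.1 js + 1) * (n.1 (-js) + 1) := by ring
  rw [h6, Real.sqrt_mul (by positivity), Real.sqrt_mul (by positivity),
    Real.sqrt_mul (by positivity)]
  push_cast
  ring

theorem Promotes.inj {n m n' : Occ d N} (h : Promotes js n n') (hm : Promotes js m n') : n = m :=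
  Subtype.ext (add_right_cancel (add_right_cancel (h.symm.trans hm)))

/-- `W X W*` is diagonal if `X` is. -/
theorem isDiag_W_mul_mul_Wstar (hjs : js ≠ 0) {X : FockN d N →L[ℂ] FockN d N} {v u : Occ d N → ℝ}
    (hX : IsDiag X v) (hu0 : ∀ n, n.1 0 < 2 → u n = 0)
    (hu : ∀ n n', Promotes js n n' → u n = wCoeff N φ js n ^ 2 * v n') :
    IsDiag (W d N φ js * X * Wstar d N φ js) u := by
  intro ψ n
  simp only [mul_apply_eq_comp]
  by_cases h : n.1 0 < 2
  · rw [W_apply_of_lt h, hu0 n h]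
    simp
  · obtain ⟨n', hn'⟩ := exists_promote js n (not_lt.mp h)
    rw [W_apply hjs hn', hX, hu n n' hn', ← inner_basisVec n', Wstar,
      ContinuousLinearMap.adjoint_inner_right]
    -- The coefficient of `W* ψ` at `n'` is now the inner product of `W` applied to this basis
    -- vector with `ψ`. As promotion is injective, only the coefficient at `n` survives.
    have h1 : W d N φ js (basisVec n') = (wCoeff N φ js n : ℂ) • basisVec n := by
      ext m
      rw [lp.coeFn_smul, Pi.smul_apply, smul_eq_mul]
      by_cases hm : m.1 0 < 2
      · rw [W_apply_of_lt hm, basisVec_apply_ne (by rintro rfl; exact h hm), mul_zero]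
      · obtain ⟨m', hm'⟩ := exists_promote js m (not_lt.mp hm)
        rw [W_apply hjs hm']
        by_cases hmn : m = n
        · subst hmn
          have : m' = n' := Subtype.ext (add_right_cancel (hm'.trans hn'.symm))
          rw [this, basisVec_apply_self, basisVec_apply_self]
        · have : m' ≠ n' := by
            rintro rfl
            exact hmn (Promotes.inj hm' hn')
          rw [basisVec_apply_ne this, basisVec_apply_ne hmn, mul_zero, mul_zero]
    rw [h1, inner_smul_left, inner_basisVec, Complex.conj_ofReal]
    push_cast
    ring

end Ladder

/-! ### The sectors of `Q^{(i,i+1)}` and the diagonal form of `Q (H - z) Q`. -/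

section Sector

variable {d N : ℕ} {js : Mode d} {φ L z : ℝ}

/-- `n` has `N - i` or `N - i - 1` particles in the modes `±j*`. -/
def InSector (js : Mode d) (i : ℕ) (n : Occ d N) : Prop :=
  n.1 js + n.1 (-js) + i = N ∨ n.1 js + n.1 (-js) + i + 1 = N

open Classical in
/-- The indicator function of a sector times `v`. -/
noncomputable def onSector (js : Mode d) (i : ℕ) (v : Occ d N → ℝ) (n : Occ d N) : ℝ :=
  if InSector js i n then v n else 0

theorem onSector_of_mem {i : ℕ} {v : Occ d N → ℝ} {n : Occ d N} (h : InSector js i n) :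
    onSector js i v n = v n := if_pos h

theorem onSector_of_notMem {i : ℕ} {v : Occ d N → ℝ} {n : Occ d N} (h : ¬ InSector js i n) :
    onSector js i v n = 0 := if_neg h

theorem isDiag_Q (i : ℕ) : IsDiag (Q d N js i) (onSector js i fun _ => 1) := by
  intro ψ n
  change ite _ (1 : ℂ) 0 * ψ n = _
  by_cases h : n.1 js + n.1 (-js) + i = N ∨ n.1 js + n.1 (-js) + i + 1 = N
  · rw [onSector_of_mem h, if_pos h, Complex.ofReal_one]
  · rw [onSector_of_notMem h, if_neg h, Complex.ofReal_zero]

theorem occ_add_le (hjs : js ≠ 0) (n : Occ d N) : n.1 js + n.1 (-js) + n.1 0 ≤ N := by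
  classical
  have h2 : -js ≠ 0 := neg_ne_zero.mpr hjs
  have h3 := neg_ne_self_of_ne_zero hjs
  have h1 : ∑ i ∈ ({js, -js, 0} : Finset (Mode d)), n.1 i = n.1 js + n.1 (-js) + n.1 0 := by
    rw [Finset.sum_insert (by simp [h3.symm, hjs]), Finset.sum_pair h2, add_assoc]
  have h4 : ∑ i ∈ ({js, -js, 0} : Finset (Mode d)) ∪ n.1.support, n.1 i = N := by
    rw [← Finset.sum_subset Finset.subset_union_right
      (fun x _ hx => Finsupp.notMem_support_iff.mp hx)]
    exact n.2
  exact (h1.symm.trans_le (Finset.sum_le_sum_of_subset Finset.subset_union_left)).trans h4.le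

/-- Keeps the sectors with `i ≤ N - 2` away from the condensate, where the lower bounds on `schur`
apply. -/
theorem one_le_of_inSector {k : ℕ} (hk : 2 * k + 2 ≤ N) {n : Occ d N} (h : InSector js (2 * k) n) :
    1 ≤ n.1 js + n.1 (-js) := by
  unfold InSector at h
  omega

theorem Promotes.inSector_iff {n n' : Occ d N} (h : Promotes js n n') (hjs : js ≠ 0) (i : ℕ) :
    InSector js (i + 2) n ↔ InSector js i n' := by
  unfold InSector
  rw [h.pos hjs, h.neg hjs]
  omega

theorem kSq_nonneg (j : Mode d) : 0 ≤ kSq L j := Finset.sum_nonneg fun _ _ => sq_nonneg _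

theorem kSq_zero : kSq L (0 : Mode d) = 0 := by simp [kSq]

theorem kSq_pos (hL : 0 < L) (hjs : js ≠ 0) : 0 < kSq L js := by
  obtain ⟨i, hi⟩ := Function.ne_iff.mp hjs
  have hi' : (js i : ℝ) ≠ 0 := by exact_mod_cast hi
  refine Finset.sum_pos' (fun _ _ => sq_nonneg _) ⟨i, Finset.mem_univ _, ?_⟩
  have := Real.pi_pos
  positivity

theorem kinOther_nonneg (n : Occ d N) : 0 ≤ kinOther L js n := by
  refine Finset.sum_nonneg fun j _ => ?_
  dsimp only
  split_ifs
  · exact le_rfl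
  · exact mul_nonneg (kSq_nonneg _) (Nat.cast_nonneg _)

/-- The mode `0` has no kinetic energy and `±j*` are left out of the sum, so `κ` is constant along a
chain. -/
theorem Promotes.kinOther_eq {n n' : Occ d N} (h : Promotes js n n') :
    kinOther L js n' = kinOther L js n := by
  obtain ⟨F, hF⟩ : ∃ F : Mode d → ℕ → ℝ,
    F = fun (j : Mode d) (m : ℕ) => if j = js ∨ j = -js then 0 else kSq L j * (m : ℝ) := ⟨_, rfl⟩
  have h0 : ∀ j, F j 0 = 0 := by
    intro j
    rw [hF]
    simp
  have hadd : ∀ j a b, F j (a + b) = F j a + F j b := by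
    intro j a b
    rw [hF]
    dsimp only
    split_ifs
    · simp
    · push_cast
      ring
  have hz : ∀ j m, j = js ∨ j = -js ∨ j = 0 → F j m = 0 := by
    rintro j m (rfl | rfl | rfl) <;> rw [hF] <;> simp [kSq_zero]
  have key := congrArg (fun m : Mode d →₀ ℕ => m.sum F) h
  simp only [Finsupp.sum_add_index' h0 hadd, Finsupp.sum_single_index (h0 _)] at key
  rw [hz 0 2 (by simp), hz js 1 (by simp), hz (-js) 1 (by simp), add_zero, add_zero, add_zero,
    hF] at key
  exact key

/-- The diagonal matrix element of `H - z` on a product state. -/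
noncomputable def levOcc (L φ : ℝ) (js : Mode d) (z : ℝ) (n : Occ d N) : ℝ :=
  lev (kSq L js) φ N (kinOther L js n) z (n.1 js) (n.1 (-js)) (n.1 0)

/-- The Schur complement of `H - z` on a product state. -/
noncomputable def schurOcc (L φ : ℝ) (js : Mode d) (z : ℝ) (n : Occ d N) : ℝ :=
  schur (kSq L js) φ N (kinOther L js n) z (n.1 js) (n.1 (-js)) (n.1 0)

theorem levOcc_sub_schurOcc_of_lt {n : Occ d N} (h : n.1 0 < 2) :
    levOcc L φ js z n - schurOcc L φ js z n = 0 := by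
  unfold levOcc schurOcc
  rw [sub_eq_zero]
  interval_cases n.1 0 <;> rw [schur]

/-- The recursion of `schur`, written with the squared matrix element of `W`; this identifies the
entries of `Γ` as level minus Schur complement. -/
theorem Promotes.levOcc_sub_schurOcc {n n' : Occ d N} (h : Promotes js n n') (hjs : js ≠ 0) :
    levOcc L φ js z n - schurOcc L φ js z n = wCoeff N φ js n ^ 2 * (schurOcc L φ js z n')⁻¹ := by
  unfold levOcc schurOcc wCoeff
  rw [h.pos hjs, h.neg hjs, h.kinOther_eq, ← h.zero hjs, schur, mul_pow, Real.sq_sqrt]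
  · push_cast
    ring
  · push_cast
    have : (0 : ℝ) ≤ (n'.1 0 : ℝ) + 2 - 1 := by
      have : (0 : ℝ) ≤ (n'.1 0 : ℝ) := Nat.cast_nonneg _
      linarith
    positivity

/-- `W X W*` for the operator `X` with the inverse Schur complements of one sector. -/
theorem isDiag_W_inv_schur_Wstar (hjs : js ≠ 0) {i : ℕ} {X : FockN d N →L[ℂ] FockN d N}
    (hX : IsDiag X (onSector js i fun n => (schurOcc L φ js z n)⁻¹)) :
    IsDiag (W d N φ js * X * Wstar d N φ js)
      (onSector js (i + 2) fun n => levOcc L φ js z n - schurOcc L φ js z n) := by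
  refine isDiag_W_mul_mul_Wstar hjs hX (fun n hn => ?_) fun n n' h => ?_
  · by_cases hs : InSector js (i + 2) n
    · rw [onSector_of_mem hs, levOcc_sub_schurOcc_of_lt hn]
    · exact onSector_of_notMem hs
  · by_cases hs : InSector js (i + 2) n
    · rw [onSector_of_mem hs, onSector_of_mem ((h.inSector_iff hjs i).mp hs),
        h.levOcc_sub_schurOcc hjs]
    · rw [onSector_of_notMem hs, onSector_of_notMem (mt (h.inSector_iff hjs i).mpr hs), mul_zero]

/-- A sector holds two consecutive values of the number of particles in `±j*`, while `W` shifts this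
number by two. -/
theorem Q_mul_W_mul_Q (hjs : js ≠ 0) (i : ℕ) : Q d N js i * W d N φ js * Q d N js i = 0 := by
  ext ψ n
  simp only [mul_apply_eq_comp, zero_apply, lp.coeFn_zero, Pi.zero_apply]
  rw [isDiag_Q]
  by_cases h : n.1 0 < 2
  · rw [W_apply_of_lt h, mul_zero]
  · obtain ⟨n', hn'⟩ := exists_promote js n (not_lt.mp h)
    rw [W_apply hjs hn', isDiag_Q]
    by_cases hs : InSector js i n
    · have : ¬ InSector js i n' := by
        rw [← hn'.inSector_iff hjs]
        unfold InSector at hs ⊢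
        omega
      rw [onSector_of_notMem this]
      simp
    · rw [onSector_of_notMem hs]
      simp

theorem Q_mul_Wstar_mul_Q (hjs : js ≠ 0) (i : ℕ) :
    Q d N js i * Wstar d N φ js * Q d N js i = 0 := by
  have h1 := congrArg adjoint (Q_mul_W_mul_Q (N := N) (φ := φ) hjs i)
  rw [mul_def, mul_def, adjoint_comp, adjoint_comp, (isDiag_Q i).adjoint_eq, map_zero] at h1
  rw [mul_def, mul_def, Wstar, ← h1]
  rfl

theorem hBog_apply (ψ : (hBog d N L φ js).domain) (n : Occ d N) :
    (hBog d N L φ js ψ) n = ((levOcc L φ js 0 n : ℝ) : ℂ) * (ψ : FockN d N) n +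
      W d N φ js ψ n + Wstar d N φ js ψ n := by
  change (kinOther L js n : ℂ) * (ψ : FockN d N) n +
    (hHat0 d N L φ js + W d N φ js + Wstar d N φ js : FockN d N →L[ℂ] FockN d N) ψ n = _
  have h0 : hHat0 d N L φ js (ψ : FockN d N) n =
      (((kSq L js + φ / N * n.1 0) * ((n.1 js : ℝ) + n.1 (-js)) : ℝ) : ℂ) * (ψ : FockN d N) n := by
    simp only [hHat0, add_apply, mul_apply_eq_comp, smul_apply, one_apply_eq_self, lp.coeFn_add,
      lp.coeFn_smul, Pi.add_apply, Pi.smul_apply, smul_eq_mul]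
    simp only [isDiag_num _ _ _]
    push_cast
    ring
  simp only [add_apply, lp.coeFn_add, Pi.add_apply, h0, levOcc, lev]
  push_cast
  ring

/-- On a sector, `Q (H - z) Q` is diagonal. -/
theorem Q_hBog_apply (hjs : js ≠ 0) {i : ℕ} (ψ : (hBog d N L φ js).domain)
    (hψ : Q d N js i ψ = ψ) (n : Occ d N) :
    Q d N js i (hBog d N L φ js ψ - (z : ℂ) • (ψ : FockN d N)) n =
      ((onSector js i (levOcc L φ js z) n : ℝ) : ℂ) * (ψ : FockN d N) n := by
  have h1 := congrArg (fun X : FockN d N →L[ℂ] FockN d N => X ψ n) (Q_mul_W_mul_Q (φ := φ) hjs i)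
  have h2 := congrArg (fun X : FockN d N →L[ℂ] FockN d N => X ψ n)
    (Q_mul_Wstar_mul_Q (φ := φ) hjs i)
  simp only [mul_apply_eq_comp, hψ, zero_apply, lp.coeFn_zero, Pi.zero_apply] at h1 h2
  rw [isDiag_Q] at h1 h2 ⊢
  rw [lp.coeFn_sub, Pi.sub_apply, hBog_apply, lp.coeFn_smul, Pi.smul_apply, smul_eq_mul]
  by_cases hs : InSector js i n
  · rw [onSector_of_mem hs] at h1 h2 ⊢
    rw [onSector_of_mem hs]
    simp only [levOcc, lev] at h1 h2 ⊢
    push_cast at h1 h2 ⊢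
    linear_combination h1 + h2
  · rw [onSector_of_notMem hs, onSector_of_notMem hs]
    simp

end Sector

/-! ### Uniqueness of the reduced resolvent. -/

/-- `R' ψ` lies in the range of `Q`, so `R' ψ = R (Q (H - z) R' ψ) = R Q ψ = R ψ`. Hence the choice
made in `reducedResolvent` is harmless. -/
theorem IsReducedResolvent.unique {E : Type*} [NormedAddCommGroup E] [NormedSpace ℂ E]
    {H : E →ₗ.[ℂ] E} {Q : E →L[ℂ] E} {z : ℂ} {R R' : E →L[ℂ] E}
    (h : IsReducedResolvent H Q z R) (h' : IsReducedResolvent H Q z R') : R = R' := by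
  ext ψ
  have h1 := h.left_inv ⟨R' ψ, h'.mem_domain ψ⟩
    (congrArg (fun X : E →L[ℂ] E => X ψ) h'.left_proj)
  rw [h'.right_inv ψ] at h1
  refine Eq.trans ?_ h1
  exact congrArg (fun X : E →L[ℂ] E => X ψ) h.right_proj.symm

theorem IsReducedResolvent.reducedResolvent_eq {E : Type*} [NormedAddCommGroup E]
    [NormedSpace ℂ E] {H : E →ₗ.[ℂ] E} {Q : E →L[ℂ] E} {z : ℂ} {R : E →L[ℂ] E}
    (h : IsReducedResolvent H Q z R) : reducedResolvent H Q z = R := by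
  have hex : ∃ R, IsReducedResolvent H Q z R := ⟨R, h⟩
  unfold reducedResolvent
  rw [dif_pos hex]
  exact hex.choose_spec.unique h

/-! ### From the operator recursion to the continued fraction. -/

section FeshbachFlow

variable {d N : ℕ} {js : Mode d} {φ L z p : ℝ}

/-- The Schur complements at energy `z` away from the condensate state are bounded below by the
kinetic energy of the other modes plus `p`. -/
def SchurBound (N : ℕ) (K φ z p : ℝ) : Prop :=
  ∀ κ, 0 ≤ κ → ∀ a b c : ℕ, 1 ≤ a + b → a + b + c ≤ N → κ + p ≤ schur K φ N κ z a b c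

theorem SchurBound.le_schurOcc (hb : SchurBound N (kSq L js) φ z p) (hjs : js ≠ 0) {k : ℕ}
    (hk : 2 * k + 2 ≤ N) {n : Occ d N} (h : InSector js (2 * k) n) :
    kinOther L js n + p ≤ schurOcc L φ js z n :=
  hb _ (kinOther_nonneg n) _ _ _ (one_le_of_inSector hk h) (occ_add_le hjs n)

theorem SchurBound.schurOcc_le (hb : SchurBound N (kSq L js) φ z p) (hp : 0 < p) (hjs : js ≠ 0)
    (n : Occ d N) : schurOcc L φ js z n ≤ levOcc L φ js z n :=
  schur_le_lev (fun a b c hab hc => by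
    linarith [hb _ (kinOther_nonneg (L := L) (js := js) n) a b c hab hc,
      kinOther_nonneg (L := L) (js := js) n]) (occ_add_le hjs n)

theorem levOcc_le (hφ : 0 < φ) (hN : 0 < N) (hjs : js ≠ 0) (n : Occ d N) :
    levOcc L φ js z n ≤ kinOther L js n + ((kSq L js + φ) * N - z) := by
  have hNr : (0 : ℝ) < N := by exact_mod_cast hN
  have h1 : (n.1 js : ℝ) + n.1 (-js) + n.1 0 ≤ N := by exact_mod_cast occ_add_le hjs n
  have h2 : (0 : ℝ) ≤ n.1 0 := Nat.cast_nonneg _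
  have h3 : (0 : ℝ) ≤ n.1 js := Nat.cast_nonneg _
  have h4 : (0 : ℝ) ≤ n.1 (-js) := Nat.cast_nonneg _
  have h5 : φ / N * n.1 0 ≤ φ := by
    rw [div_mul_eq_mul_div, div_le_iff₀ hNr]
    gcongr
    have := occ_add_le hjs n
    omega
  have h6 : (kSq L js + φ / N * n.1 0) * ((n.1 js : ℝ) + n.1 (-js)) ≤ (kSq L js + φ) * N := by
    have := kSq_nonneg (L := L) js
    gcongr
    linarith
  unfold levOcc lev
  linarith

/-- Existence of the reduced resolvent of a sector. -/
theorem exists_isReducedResolvent (hb : SchurBound N (kSq L js) φ z p) (hp : 0 < p)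
    (hjs : js ≠ 0) {k : ℕ} (hk : 2 * k + 2 ≤ N) :
    ∃ R, IsReducedResolvent (hBog d N L φ js) (Q d N js (2 * k)) (z : ℂ) R ∧
      IsDiag R (onSector js (2 * k) fun n => (levOcc L φ js z n)⁻¹) := by
  have hlev : ∀ n : Occ d N, InSector js (2 * k) n → kinOther L js n + p ≤ levOcc L φ js z n :=
    fun n hn => (hb.le_schurOcc hjs hk hn).trans (hb.schurOcc_le hp hjs n)
  have hlev0 : ∀ n : Occ d N, InSector js (2 * k) n → 0 < levOcc L φ js z n :=
    fun n hn => by linarith [hlev n hn, kinOther_nonneg (L := L) (js := js) n]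
  obtain ⟨R, hR⟩ := IsDiag.exists_of_bounded
    (onSector (N := N) js (2 * k) fun n => (levOcc L φ js z n)⁻¹) p⁻¹ (by
      intro n
      by_cases hn : InSector js (2 * k) n
      · rw [onSector_of_mem hn, abs_of_pos (inv_pos.mpr (hlev0 n hn))]
        exact inv_anti₀ hp (by linarith [hlev n hn, kinOther_nonneg (L := L) (js := js) n])
      · rw [onSector_of_notMem hn, abs_zero]
        positivity) (by positivity)
  -- `Y` is the kinetic operator times `R`. Its boundedness, from `κ ≤ lev`, puts the range of `R`
  -- into the domain of `H`.
  obtain ⟨Y, hY⟩ := IsDiag.exists_of_bounded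
    (fun n : Occ d N => kinOther L js n * onSector js (2 * k) (fun n => (levOcc L φ js z n)⁻¹) n) 1
    (by
      intro n
      by_cases hn : InSector js (2 * k) n
      · have h0 := hlev0 n hn
        have h1 := kinOther_nonneg (L := L) (js := js) n
        rw [onSector_of_mem hn, abs_of_nonneg (by positivity), ← div_eq_mul_inv, div_le_one h0]
        linarith [hlev n hn]
      · rw [onSector_of_notMem hn, mul_zero, abs_zero]
        positivity) zero_le_one
  have hQR : Q d N js (2 * k) * R = R := by
    refine ((isDiag_Q _).mul hR).ext hR fun n => ?_
    by_cases hn : InSector js (2 * k) n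
    · simp only [onSector_of_mem hn, one_mul]
    · simp only [onSector_of_notMem hn, mul_zero]
  have hRQ : R * Q d N js (2 * k) = R := by
    refine (hR.mul (isDiag_Q _)).ext hR fun n => ?_
    by_cases hn : InSector js (2 * k) n
    · simp only [onSector_of_mem hn, mul_one]
    · simp only [onSector_of_notMem hn, mul_zero]
  have hdom : ∀ ψ, R ψ ∈ (hBog d N L φ js).domain := by
    intro ψ
    change Memℓp (fun n : Occ d N => (kinOther L js n : ℂ) * R ψ n) 2
    refine (congrArg (fun f => Memℓp f 2) ?_).mp (lp.memℓp (Y ψ))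
    ext n
    rw [hY, hR]
    push_cast
    ring
  refine ⟨R, ⟨hQR, hRQ, hdom, fun ψ => ?_, fun ψ hψ => ?_⟩, hR⟩
  · ext n
    rw [Q_hBog_apply hjs ⟨R ψ, hdom ψ⟩ (congrArg (fun X : FockN d N →L[ℂ] FockN d N => X ψ) hQR),
      hR, isDiag_Q]
    by_cases hn : InSector js (2 * k) n
    · simp only [onSector_of_mem hn]
      rw [← mul_assoc, ← Complex.ofReal_mul, mul_inv_cancel₀ (hlev0 n hn).ne']
    · simp only [onSector_of_notMem hn, Complex.ofReal_zero, zero_mul]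
  · ext n
    rw [hR, Q_hBog_apply hjs ψ hψ, ← hψ, isDiag_Q]
    by_cases hn : InSector js (2 * k) n
    · simp only [onSector_of_mem hn]
      rw [← mul_assoc, ← Complex.ofReal_mul, inv_mul_cancel₀ (hlev0 n hn).ne',
        Complex.ofReal_one, one_mul]
    · simp only [onSector_of_notMem hn, Complex.ofReal_zero, zero_mul]

theorem isDiag_resBog (hb : SchurBound N (kSq L js) φ z p) (hp : 0 < p)
    (hjs : js ≠ 0) {k : ℕ} (hk : 2 * k + 2 ≤ N) :
    IsDiag (resBog d N L φ js z (2 * k))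
      (onSector js (2 * k) fun n => (levOcc L φ js z n)⁻¹) := by
  obtain ⟨R, hR, hR'⟩ := exists_isReducedResolvent (d := d) hb hp hjs hk
  rw [resBog, hR.reducedResolvent_eq]
  exact hR'

/-- Uniform bound for the diagonal of `Γ R`. -/
theorem exists_gamma_res_bound (hb : SchurBound N (kSq L js) φ z p) (hp : 0 < p) (hφ : 0 < φ)
    (hN : 0 < N) (hjs : js ≠ 0) {k : ℕ} (hk : 2 * k + 2 ≤ N) :
    ∃ C, 0 ≤ C ∧ C < 1 ∧ ∀ n : Occ d N,
      |onSector js (2 * k) (fun n => levOcc L φ js z n - schurOcc L φ js z n) n *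
        onSector js (2 * k) (fun n => (levOcc L φ js z n)⁻¹) n| ≤ C := by
  -- The entries are `1 - schur/lev`. Since `lev ≤ κ + Λ`, one has `schur/lev ≥ (κ+p)/(κ+Λ) ≥ p/Λ`,
  -- uniformly in the unbounded `κ`. The summand `p` ensures `p ≤ Λ`.
  set Λ := |(kSq L js + φ) * N - z| + p with hΛ
  have hΛp : p ≤ Λ := by rw [hΛ]; linarith [abs_nonneg ((kSq L js + φ) * N - z)]
  have hΛ0 : 0 < Λ := hp.trans_le hΛp
  have hδ : p / Λ ≤ 1 := (div_le_one hΛ0).mpr hΛp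
  refine ⟨1 - p / Λ, by linarith, by linarith [div_pos hp hΛ0], fun n => ?_⟩
  by_cases hn : InSector js (2 * k) n
  · simp only [onSector_of_mem hn]
    have h1 := hb.le_schurOcc hjs hk hn
    have h2 := hb.schurOcc_le hp hjs n
    have h3 := levOcc_le (L := L) (z := z) hφ hN hjs n
    have h4 := kinOther_nonneg (L := L) (js := js) n
    have h5 : 0 < levOcc L φ js z n := by linarith
    rw [abs_of_nonneg (mul_nonneg (by linarith) (inv_nonneg.mpr h5.le)), ← div_eq_mul_inv,
      div_le_iff₀ h5]
    have h6 : p / Λ * levOcc L φ js z n ≤ p / Λ * (kinOther L js n + Λ) := by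
      gcongr
      have := le_abs_self ((kSq L js + φ) * N - z)
      linarith
    have h7 : p / Λ * (kinOther L js n + Λ) = p / Λ * kinOther L js n + p := by
      field_simp
    have h8 : p / Λ * kinOther L js n ≤ 1 * kinOther L js n := by gcongr
    linarith
  · rw [onSector_of_notMem hn, zero_mul, abs_zero]
    linarith

/-- Entrywise, `lev⁻¹ (1 - (lev - schur)/lev)⁻¹ = schur⁻¹`. -/
theorem isDiag_res_mul_tsum (hb : SchurBound N (kSq L js) φ z p) (hp : 0 < p) (hφ : 0 < φ)
    (hN : 0 < N) (hjs : js ≠ 0) {k : ℕ} (hk : 2 * k + 2 ≤ N) {G : FockN d N →L[ℂ] FockN d N}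
    (hG : IsDiag G (onSector js (2 * k) fun n => levOcc L φ js z n - schurOcc L φ js z n)) :
    IsDiag (resBog d N L φ js z (2 * k) * ∑' l : ℕ, (G * resBog d N L φ js z (2 * k)) ^ l)
      (onSector js (2 * k) fun n => (schurOcc L φ js z n)⁻¹) := by
  have hR := isDiag_resBog (d := d) hb hp hjs hk
  obtain ⟨C, hC0, hC1, hC⟩ := exists_gamma_res_bound (d := d) hb hp hφ hN hjs hk
  refine (hR.mul ((hG.mul hR).tsum_pow hC0 hC1 hC)).congr fun n => ?_
  by_cases hn : InSector js (2 * k) n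
  · simp only [onSector_of_mem hn]
    have h1 := hb.le_schurOcc hjs hk hn
    have h2 := hb.schurOcc_le hp hjs n
    have h4 := kinOther_nonneg (L := L) (js := js) n
    have h5 : levOcc L φ js z n ≠ 0 := by linarith
    rw [← mul_inv]
    congr 1
    field_simp
    ring
  · simp only [onSector_of_notMem hn, zero_mul]

/-- The operators `Γ` are diagonal. -/
theorem isDiag_gammaBog (hb : SchurBound N (kSq L js) φ z p) (hp : 0 < p) (hφ : 0 < φ)
    (hN : 0 < N) (hjs : js ≠ 0) : ∀ k : ℕ, 2 * k + 2 ≤ N →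
    IsDiag (gammaBog d N L φ js z k)
      (onSector js (2 * k) fun n => levOcc L φ js z n - schurOcc L φ js z n) := by
  intro k
  induction k with
  | zero =>
    intro hk ψ n
    -- In the sector `i = 0` at most one particle is outside `±j*`, so the mode `0` has no pair to
    -- give and `lev = schur`.
    have h0 : onSector js (2 * 0) (fun n => levOcc L φ js z n - schurOcc L φ js z n) n = 0 := by
      by_cases hn : InSector js (2 * 0) n
      · rw [onSector_of_mem hn]
        refine levOcc_sub_schurOcc_of_lt ?_
        have := occ_add_le hjs n
        unfold InSector at hn
        omega
      · exact onSector_of_notMem hn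
    rw [h0, gammaBog]
    simp
  | succ k ih =>
    intro hk
    have hk' : 2 * k + 2 ≤ N := by omega
    have hX := isDiag_res_mul_tsum hb hp hφ hN hjs hk' (ih hk')
    have hQXQ := ((isDiag_Q (js := js) (2 * k)).mul hX).mul (isDiag_Q (js := js) (2 * k))
    have hQXQ' := hQXQ.congr (w := onSector js (2 * k) fun n => (schurOcc L φ js z n)⁻¹) (by
      intro n
      by_cases hn : InSector js (2 * k) n
      · simp only [onSector_of_mem hn, one_mul, mul_one]
      · simp only [onSector_of_notMem hn, mul_zero])
    have hW := isDiag_W_inv_schur_Wstar hjs hQXQ'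
    have hfin := ((isDiag_Q (js := js) (2 * k + 2)).mul hW).mul (isDiag_Q (js := js) (2 * k + 2))
    rw [gammaBog]
    have hfin' := hfin.congr (w := onSector js (2 * k + 2)
        fun n => levOcc L φ js z n - schurOcc L φ js z n) (by
      intro n
      by_cases hn : InSector js (2 * k + 2) n
      · simp only [onSector_of_mem hn, one_mul, mul_one]
      · simp only [onSector_of_notMem hn, mul_zero])
    change IsDiag _ (onSector js (2 * k + 2) _)
    convert hfin' using 1
    simp only [mul_assoc]

theorem fWellDefined_of_schurBound (hb : SchurBound N (kSq L js) φ z p) (hp : 0 < p) (hφ : 0 < φ)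
    (hN : 0 < N) (hjs : js ≠ 0) : FWellDefined d N L φ js z := by
  intro k hk
  obtain ⟨R, hR, -⟩ := exists_isReducedResolvent (d := d) hb hp hjs hk
  obtain ⟨C, hC0, hC1, hC⟩ := exists_gamma_res_bound (d := d) hb hp hφ hN hjs hk
  exact ⟨⟨R, hR⟩, ((isDiag_gammaBog hb hp hφ hN hjs k hk).mul
    (isDiag_resBog hb hp hjs hk)).summable_pow hC0 hC1 hC⟩

/-- `f(z)` is the Schur complement of `H - z` onto the condensate state. -/
theorem f_eq_schur (hb : SchurBound N (kSq L js) φ z p) (hp : 0 < p) (hφ : 0 < φ)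
    (hN : 0 < N) (hE : Even N) (hjs : js ≠ 0) :
    f d N L φ js z = ((schur (kSq L js) φ N 0 z 0 0 N : ℝ) : ℂ) := by
  obtain ⟨k, hk⟩ : ∃ k, N = 2 * k + 2 := by
    obtain ⟨l, hl⟩ := hE
    exact ⟨l - 1, by omega⟩
  have hN2 : N - 2 = 2 * k := by omega
  have hNk : N / 2 - 1 = k := by omega
  have hW := isDiag_W_inv_schur_Wstar hjs (isDiag_res_mul_tsum hb hp hφ hN hjs hk.ge
    (isDiag_gammaBog (d := d) hb hp hφ hN hjs k hk.ge))
  have h0 : eta d N = basisVec ⟨Finsupp.single 0 N, by simp⟩ := rfl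
  -- The condensate lies in the sector of index `N`, so the inner product in `f` is one more step of
  -- the recursion and equals `lev - schur`. There `lev = -z`, and `f z = schur` follows.
  have hs : InSector (N := N) js (2 * k + 2) ⟨Finsupp.single 0 N, by simp⟩ := by
    left
    simp [hjs.symm, (neg_ne_zero.mpr hjs).symm, hk]
  have hkin : kinOther (N := N) L js ⟨Finsupp.single 0 N, by simp⟩ = 0 := by
    unfold kinOther
    rw [Finsupp.sum_single_index (by simp)]
    simp [kSq_zero]
  rw [f, hN2, hNk, h0, inner_basisVec, mul_assoc (W d N φ js), hW, basisVec_apply_self,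
    onSector_of_mem hs, levOcc, schurOcc, hkin, lev]
  simp [hjs.symm, (neg_ne_zero.mpr hjs).symm]

end FeshbachFlow

/-! ### Scaling, the zero of the scalar function, and the conclusion. -/

variable {d : ℕ} {L φ : ℝ} {js : Mode d}

theorem scaled_eps {ε : ℝ} (h0 : 0 < ε) (h1 : ε ≤ 1 / 100) :
    Scaled ε (Real.sqrt ε) (Real.sqrt (ε ^ 2 + 2 * ε)) where
  pos := Real.sqrt_pos.mpr h0
  small := by
    rw [Real.sqrt_le_left (by norm_num)]
    norm_num
    linarith
  sq := (Real.sq_sqrt h0.le).symm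
  s_pos := Real.sqrt_pos.mpr (by positivity)
  s_sq := Real.sq_sqrt (by positivity)

theorem eBog_eq (hφ : 0 < φ) :
    eBog L φ js = φ * -(1 + eps L φ js - Real.sqrt (eps L φ js ^ 2 + 2 * eps L φ js)) := by
  have hK : kSq L js = φ * eps L φ js := by
    unfold eps
    field_simp
  have h1 : kSq L js ^ 2 + 2 * φ * kSq L js =
      φ ^ 2 * (eps L φ js ^ 2 + 2 * eps L φ js) := by
    rw [hK]; ring
  rw [eBog, h1, Real.sqrt_mul (sq_nonneg _), Real.sqrt_sq hφ.le]
  rw [hK]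
  ring

/-- A strictly decreasing continuous scalar Schur complement has exactly one zero below the
threshold as soon as it is negative somewhere below it. -/
theorem exists_unique_zero {K : ℝ} {N : ℕ} {zmax z₂ : ℝ} (hz₂ : z₂ ≤ zmax)
    (hpos : ∀ z ≤ zmax, ∀ a b c : ℕ, 1 ≤ a + b → a + b + c ≤ N → 0 < schur K φ N 0 z a b c)
    (hneg : schur K φ N 0 z₂ 0 0 N < 0) :
    ∃ zs < z₂, schur K φ N 0 zs 0 0 N = 0 ∧
      ∀ z ≤ zmax, schur K φ N 0 z 0 0 N = 0 → z = zs := by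
  have hmono : ∀ z z', z ≤ z' → z' ≤ zmax →
      schur K φ N 0 z' 0 0 N + (z' - z) ≤ schur K φ N 0 z 0 0 N :=
    fun z z' h h' => schur_add_le h (hpos z' h') N 0 0 (by omega)
  -- Slope at most `-1` forces a nonnegative value once the energy is lowered from `z₂` by the
  -- modulus of the value there.
  have hle : z₂ + schur K φ N 0 z₂ 0 0 N ≤ z₂ := by linarith
  have hcont : ContinuousOn (fun z => schur K φ N 0 z 0 0 N)
      (Set.Icc (z₂ + schur K φ N 0 z₂ 0 0 N) z₂) :=
    continuousOn_schur (fun z hz => hpos z (hz.2.trans hz₂)) N 0 0 (by omega)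
  obtain ⟨zs, hzs, h0⟩ := intermediate_value_Icc' hle hcont
    (show (0 : ℝ) ∈ _ from ⟨hneg.le, by linarith [hmono _ _ hle hz₂]⟩)
  have hlt : zs < z₂ := lt_of_le_of_ne hzs.2 (by rintro rfl; exact hneg.ne h0)
  refine ⟨zs, hlt, h0, fun z hz hz0 => ?_⟩
  dsimp only at h0
  rcases le_total z zs with h | h
  · linarith [hmono z zs h (hlt.le.trans hz₂)]
  · linarith [hmono zs z h hz]

end ThreeModeBog

open ThreeModeBog

theorem mainTheorem2 (γ : ℝ) (hγ0 : 0 < γ) (hγ1 : γ < 1) :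
    ∃ kγ : ℝ, 0 < kγ ∧ ∃ ε₀ : ℝ, 0 < ε₀ ∧
      ∀ (d N : ℕ) (L φ : ℝ) (js : ThreeModeBog.Mode d), 0 < L → 0 < φ → js ≠ 0 → 0 < N → Even N →
      ∀ ε : ℝ, ε = ThreeModeBog.eps L φ js → ε ≤ ε₀ →
        ε ^ 2 + ε / (N : ℝ) ^ γ + 1 / (N : ℝ) ≤ kγ * (ε * Real.sqrt ε) →
        1 / (N : ℝ) ^ (1 - γ) ≤ kγ * ε →
      ∀ zmax : ℝ, zmax = ThreeModeBog.eBog L φ js +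
          Real.sqrt ε * φ * Real.sqrt (ε ^ 2 + 2 * ε) →
        zmax < 0 ∧
        (∀ z ≤ zmax, ThreeModeBog.FWellDefined d N L φ js z) ∧
        ∃ zs ≤ zmax, ThreeModeBog.f d N L φ js zs = 0 ∧
          (∀ z ≤ zmax, ThreeModeBog.f d N L φ js z = 0 → z = zs) ∧
          zs < ThreeModeBog.eBog L φ js +
            (2 * Real.sqrt 2 + 3) / 6 * Real.sqrt ε * φ * Real.sqrt (ε ^ 2 + 2 * ε) := by
  -- `ε₀ = 1/100` gives `e ≤ 1/10`, and `kγ = 1/10` gives `1/N ≤ e³/10`; both work for every `γ`.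
  refine ⟨1 / 10, by norm_num, 1 / 100, by norm_num, ?_⟩
  intro d N L φ js hL hφ hjs hN hE ε hε hε1 hN1 _ zmax hzmax
  have hε0 : 0 < ε := by
    rw [hε]
    exact div_pos (kSq_pos hL hjs) hφ
  have hK : kSq L js = φ * ε := by
    rw [hε]
    unfold eps
    field_simp
  have h := scaled_eps hε0 hε1
  have hEB := eBog_eq (L := L) (js := js) hφ
  rw [← hε] at hEB
  rw [hEB] at hzmax ⊢
  have hNe : 1 / (N : ℝ) ≤ 1 / 10 * Real.sqrt ε ^ 3 := by
    have h1 : 0 ≤ ε ^ 2 + ε / (N : ℝ) ^ γ := by positivity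
    have h2 : Real.sqrt ε ^ 3 = ε * Real.sqrt ε := by
      rw [pow_succ, ← h.sq]
    rw [h2]
    linarith
  generalize Real.sqrt ε = e at *
  generalize Real.sqrt (ε ^ 2 + 2 * ε) = s at *
  have hzmax' : zmax = φ * (-(1 + ε - s) + e * s) := by rw [hzmax]; ring
  have he0 := h.pos
  have hs0 := h.s_pos
  have hbound : ∀ z ≤ zmax, ∃ p > 0, SchurBound N (kSq L js) φ z p :=
    fun z hz => exists_le_schur h hφ hK hN (hzmax' ▸ hz)
  have hpos : ∀ z ≤ zmax, ∀ a b c : ℕ, 1 ≤ a + b → a + b + c ≤ N →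
      0 < schur (kSq L js) φ N 0 z a b c := by
    intro z hz a b c hab hc
    obtain ⟨p, hp, hb⟩ := hbound z hz
    linarith [hb 0 le_rfl a b c hab hc]
  have hf : ∀ z ≤ zmax, f d N L φ js z = ((schur (kSq L js) φ N 0 z 0 0 N : ℝ) : ℂ) := by
    intro z hz
    obtain ⟨p, hp, hb⟩ := hbound z hz
    exact f_eq_schur hb hp hφ hN hE hjs
  -- The constant of the theorem enters only through `9/10 ≤ c ≤ 1`.
  have hc0 : 9 / 10 ≤ (2 * Real.sqrt 2 + 3) / 6 := by
    have : 1.4 ≤ Real.sqrt 2 := Real.le_sqrt_of_sq_le (by norm_num)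
    linarith
  have hc1 : (2 * Real.sqrt 2 + 3) / 6 ≤ 1 := by
    have : Real.sqrt 2 ≤ 1.5 := Real.sqrt_le_iff.mpr (by norm_num)
    linarith
  generalize (2 * Real.sqrt 2 + 3) / 6 = c at *
  have hz₂ : φ * -(1 + ε - s) + c * e * φ * s = φ * (-(1 + ε - s) + c * e * s) := by ring
  rw [hz₂]
  have hle : φ * (-(1 + ε - s) + c * e * s) ≤ zmax := by
    rw [hzmax']
    gcongr
    exact mul_le_of_le_one_left he0.le hc1
  have hneg := schur_condensate_neg h hφ hK hN hE (θ := c * e) (by gcongr)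
    (mul_le_of_le_one_left he0.le hc1) hNe
  obtain ⟨zs, hzs, hzero, huniq⟩ := exists_unique_zero hle hpos hneg
  refine ⟨?_, fun z hz => ?_, zs, hzs.le.trans hle, ?_, fun z hz hz0 => ?_, hzs⟩
  · rw [hzmax']
    refine mul_neg_of_pos_of_neg hφ ?_
    have h1 := h.s_le
    have h2 := h.small
    have h3 : e * s ≤ 1 / 10 * s := by gcongr
    linarith
  · obtain ⟨p, hp, hb⟩ := hbound z hz
    exact fWellDefined_of_schurBound hb hp hφ hN hjs
  · rw [hf zs (hzs.le.trans hle), hzero, Complex.ofReal_zero]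
  · refine huniq z hz ?_
    rw [hf z hz] at hz0
    exact_mod_cast hz0
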